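/- Let $A=(a_{ij})_{i,j\in I}$ be a symmetrizable generalized Cartan matrix with finite index set $I$, let $(\mathfrak h,\{\alpha_i\},\{\alpha_i^\vee\})$ be a (minimal) realization of $A$ over $\mathbb C$, and let $\mathfrak g=\mathfrak g(A)$ be the associated Kac–Moody algebra: the quotient of the Lie algebra $\tilde{\mathfrak g}(A)$, generated by $e_i,f_i$ $(i\in I)$ and the vector space $\mathfrak h$ with relations $[h,h']=0$, $[e_i,f_j]=\delta_{ij}\alpha_i^\vee$, $[h,e_i]=\alpha_i(h)e_i$, $[h,f_i]=-\alpha_i(h)f_i$, by its largest ideal that intersects $\mathfrak h$ trivially. For $\alpha\in\mathfrak h^*$ put $\mathfrak g_\alpha=\{x\in\mathfrak g:[h,x]=\alpha(h)x\ \forall h\in\mathfrak h\}$, let $\Delta=\{\alpha\in\mathfrak h^*\setminus\{0\}:\mathfrak g_\alpha\ne0\}$ be the set of roots and $\Delta^{\mathrm{re}}$ the set of real roots, i.e. of roots of the form $\alpha=w(\alpha_i)$ with $w$ in the Weyl group $W$ and $i\in I$. For such $\alpha$ put $\alpha^\vee=w(\alpha_i^\vee)$ (independent of the choice of $w,i$)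 and $s_\alpha(\beta)=\beta-\beta(\alpha^\vee)\alpha$. For $\alpha\in\Delta^{\mathrm{re}}$ and $\beta\in\Delta$, the $\alpha$-string through $\beta$ is $\mathbb S(\alpha,\beta)=\{\beta+k\alpha:k\in\mathbb Z\}\cap\Delta$. A regular subalgebra is a Lie subalgebra $\mathfrak s\subseteq\mathfrak g$ with $[\mathfrak h,\mathfrak s]\subseteq\mathfrak s$; put $\Delta(\mathfrak s)=\{\alpha\in\Delta:\mathfrak g_\alpha\cap\mathfrak s\neq0\}$ and $\Delta(\mathfrak s)^{\mathrm{re}}=\Delta(\mathfrak s)\cap\Delta^{\mathrm{re}}$. It is symmetric if $\Delta(\mathfrak s)=-\Delta(\mathfrak s)$. A non-empty subset $\Psi\subseteq\Delta$ is a subroot system if $s_\alpha(\beta)\in\Psi$ for all $\alpha\in\Psi\cap\Delta^{\mathrm{re}}$ and $\beta\in\Psi$; it is real closed if $\Psi\subseteq\Delta^{\mathrm{re}}$ and $\alpha+\beta\in\Psi$ whenever $\alpha,\beta\in\Psi$ and $\alpha+\beta\in\Delta^{\mathrm{re}}$. Let $\mathfrak s$ be a symmetric regular subalgebra of $\mathfrak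 g$ and let $\alpha,\beta\in\Delta(\mathfrak s)^{\mathrm{re}}$. Then: 1. if $\alpha+\beta\in\Delta$, then $\alpha+\beta\in\Delta(\mathfrak s)$; 2. $s_\alpha(\beta)\in\Delta(\mathfrak s)$; 3. $\mathbb S(\alpha,\beta)\subseteq\Delta(\mathfrak s)$. In particular, if $\Delta(\mathfrak s)^{\mathrm{re}}$ is non-empty, then it is a real closed subroot system of $\Delta$. -/

import Mathlib

/-- Generalized Cartan matrices. -/
structure IsGCM {I : Type*} (A : Matrix I I ℤ) : Prop where
  diag : ∀ i, A i i = 2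
  nonpos : ∀ i j, i ≠ j → A i j ≤ 0
  zero_symm : ∀ i j, A i j = 0 → A j i = 0

/-- `A` is symmetrizable: `D * A` is symmetric for some invertible diagonal matrix `D`. -/
def IsSymmetrizable {I : Type*} (A : Matrix I I ℤ) : Prop :=
  ∃ d : I → ℂ, (∀ i, d i ≠ 0) ∧ ∀ i j, d i * (A i j : ℂ) = d j * (A j i : ℂ)

/-- A (minimal) realization of `A`: linearly independent simple coroots in `𝔥` and simple roots in
the dual of `𝔥`, with `⟨αⱼ, αᵢ^∨⟩ = aᵢⱼ` and `dim 𝔥 = 2 n - rank A`. -/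
structure Realization {I : Type*} [Fintype I] (A : Matrix I I ℤ)
    (𝔥 : Type*) [AddCommGroup 𝔥] [Module ℂ 𝔥] where
  simpleCoroot : I → 𝔥
  simpleRoot : I → Module.Dual ℂ 𝔥
  linearIndependent_simpleCoroot : LinearIndependent ℂ simpleCoroot
  linearIndependent_simpleRoot : LinearIndependent ℂ simpleRoot
  simpleRoot_simpleCoroot : ∀ i j, simpleRoot j (simpleCoroot i) = (A i j : ℂ)
  finrank_add_rank :
    Module.finrank ℂ 𝔥 + (A.map (fun a : ℤ => (a : ℂ))).rank = 2 * Fintype.card I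

/-- The generators `eᵢ`, `fᵢ` and `h ∈ 𝔥`. -/
inductive KMGenerator (I 𝔥 : Type*)
  | e : I → KMGenerator I 𝔥
  | f : I → KMGenerator I 𝔥
  | h : 𝔥 → KMGenerator I 𝔥

namespace Realization

noncomputable section

variable {I : Type*} [Fintype I] {A : Matrix I I ℤ} {𝔥 : Type*} [AddCommGroup 𝔥] [Module ℂ 𝔥]

/-! ### The Kac-Moody algebra -/

/-- The free Lie algebra on the generators. -/
abbrev Free (_R : Realization A 𝔥) : Type _ := FreeLieAlgebra ℂ (KMGenerator I 𝔥)

/-- The generator `eᵢ` of the free Lie algebra. -/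
def freeE (R : Realization A 𝔥) (i : I) : R.Free := FreeLieAlgebra.of ℂ (KMGenerator.e i)

/-- The generator `fᵢ` of the free Lie algebra. -/
def freeF (R : Realization A 𝔥) (i : I) : R.Free := FreeLieAlgebra.of ℂ (KMGenerator.f i)

/-- The generator of the free Lie algebra that belongs to `x ∈ 𝔥`. -/
def freeH (R : Realization A 𝔥) (x : 𝔥) : R.Free := FreeLieAlgebra.of ℂ (KMGenerator.h x)

/-- The defining relations of the auxiliary algebra `𝔤̃(A)`. The first two say that `𝔥` is mapped
linearly into it. -/
inductive Relator (R : Realization A 𝔥) : R.Free → Prop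
  | add (x y : 𝔥) : Relator R (R.freeH (x + y) - (R.freeH x + R.freeH y))
  | smul (c : ℂ) (x : 𝔥) : Relator R (R.freeH (c • x) - c • R.freeH x)
  | hh (x y : 𝔥) : Relator R ⁅R.freeH x, R.freeH y⁆
  | ef_same (i : I) : Relator R (⁅R.freeE i, R.freeF i⁆ - R.freeH (R.simpleCoroot i))
  | ef_ne (i j : I) (hij : i ≠ j) : Relator R ⁅R.freeE i, R.freeF j⁆
  | he (x : 𝔥) (i : I) : Relator R (⁅R.freeH x, R.freeE i⁆ - R.simpleRoot i x • R.freeE i)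
  | hf (x : 𝔥) (i : I) : Relator R (⁅R.freeH x, R.freeF i⁆ + R.simpleRoot i x • R.freeF i)

/-- The ideal of the free Lie algebra generated by the relations. -/
def relationIdeal (R : Realization A 𝔥) : LieIdeal ℂ R.Free :=
  LieSubmodule.lieSpan ℂ R.Free {x | R.Relator x}

/-- The auxiliary Lie algebra `𝔤̃(A)`. -/
abbrev Tilde (R : Realization A 𝔥) : Type _ := R.Free ⧸ R.relationIdeal

/-- The canonical map from `𝔥` to `𝔤̃(A)`. -/
def tildeCartan (R : Realization A 𝔥) : 𝔥 →ₗ[ℂ] R.Tilde where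
  toFun x := LieSubmodule.Quotient.mk (R.freeH x)
  map_add' x y := (Submodule.Quotient.eq R.relationIdeal.toSubmodule).2
    (LieSubmodule.subset_lieSpan (Relator.add x y))
  map_smul' c x := (Submodule.Quotient.eq R.relationIdeal.toSubmodule).2
    (LieSubmodule.subset_lieSpan (Relator.smul c x))

/-- The largest ideal of `𝔤̃(A)` that intersects the image of `𝔥` trivially (the sum of all such
ideals). -/
def radical (R : Realization A 𝔥) : LieIdeal ℂ R.Tilde :=
  sSup {J : LieIdeal ℂ R.Tilde | J.toSubmodule ⊓ LinearMap.range R.tildeCartan = ⊥}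

/-- The Kac-Moody algebra `𝔤(A)`. -/
abbrev KacMoodyAlgebra (R : Realization A 𝔥) : Type _ := R.Tilde ⧸ R.radical

/-- The canonical map from `𝔥` to `𝔤(A)`. -/
def cartan (R : Realization A 𝔥) : 𝔥 →ₗ[ℂ] R.KacMoodyAlgebra :=
  R.radical.toSubmodule.mkQ ∘ₗ R.tildeCartan

/-! ### Roots -/

/-- `𝔤_α = {x ∈ 𝔤 | [h, x] = α(h) x for all h ∈ 𝔥}`. -/
def rootSpace (R : Realization A 𝔥) (α : Module.Dual ℂ 𝔥) : Submodule ℂ R.KacMoodyAlgebra where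
  carrier := {x | ∀ h : 𝔥, ⁅R.cartan h, x⁆ = α h • x}
  add_mem' {x y} hx hy h := by rw [lie_add, hx h, hy h, smul_add]
  zero_mem' h := by rw [lie_zero, smul_zero]
  smul_mem' c x hx h := by rw [lie_smul, hx h, smul_comm]

/-- The set of roots `Δ`. -/
def roots (R : Realization A 𝔥) : Set (Module.Dual ℂ 𝔥) :=
  {α | α ≠ 0 ∧ R.rootSpace α ≠ ⊥}

/-- The Weyl group as a subgroup of `GL(𝔥)`, generated by the simple reflections
`h ↦ h - αᵢ(h) αᵢ^∨`. -/
def weylGroup (R : Realization A 𝔥) : Subgroup (𝔥 ≃ₗ[ℂ] 𝔥) :=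
  Subgroup.closure {s | ∃ i, ∀ h, s h = h - R.simpleRoot i h • R.simpleCoroot i}

/-- `(w, i)` presents `α` as `w(αᵢ)`, for the contragredient action `w(λ) = λ ∘ w⁻¹` of the Weyl
group on the dual of `𝔥`. -/
def Presents (R : Realization A 𝔥) (α : Module.Dual ℂ 𝔥) (p : (𝔥 ≃ₗ[ℂ] 𝔥) × I) : Prop :=
  p.1 ∈ R.weylGroup ∧ α = R.simpleRoot p.2 ∘ₗ (p.1⁻¹ : 𝔥 ≃ₗ[ℂ] 𝔥).toLinearMap

/-- The real roots: the roots conjugate to a simple root under the Weyl group. -/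
def realRoots (R : Realization A 𝔥) : Set (Module.Dual ℂ 𝔥) :=
  {α | α ∈ R.roots ∧ ∃ p, R.Presents α p}

open Classical in
/-- The coroot `α^∨ = w(αᵢ^∨)` of a real root `α = w(αᵢ)`; see `coroot_eq` for its independence of
the presentation. -/
def coroot (R : Realization A 𝔥) (α : Module.Dual ℂ 𝔥) : 𝔥 :=
  if hα : ∃ p, R.Presents α p then hα.choose.1 (R.simpleCoroot hα.choose.2) else 0

/-- The reflection `s_α(β) = β - β(α^∨) α` in a real root `α`. -/
def reflection (R : Realization A 𝔥) (α β : Module.Dual ℂ 𝔥) : Module.Dual ℂ 𝔥 :=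
  β - β (R.coroot α) • α

/-- The `α`-string through `β`: all roots of the form `β + k α` with `k ∈ ℤ`. -/
def rootString (R : Realization A 𝔥) (α β : Module.Dual ℂ 𝔥) : Set (Module.Dual ℂ 𝔥) :=
  {γ | γ ∈ R.roots ∧ ∃ k : ℤ, γ = β + k • α}

/-- Subroot systems of `Δ`. -/
structure IsSubrootSystem (R : Realization A 𝔥) (Ψ : Set (Module.Dual ℂ 𝔥)) : Prop where
  nonempty : Ψ.Nonempty
  subset : Ψ ⊆ R.roots
  reflection_mem : ∀ α ∈ Ψ ∩ R.realRoots, ∀ β ∈ Ψ, R.reflection α β ∈ Ψ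

/-- Real closed subsets of `Δ`. -/
structure IsRealClosed (R : Realization A 𝔥) (Ψ : Set (Module.Dual ℂ 𝔥)) : Prop where
  nonempty : Ψ.Nonempty
  subset : Ψ ⊆ R.realRoots
  add_mem : ∀ α ∈ Ψ, ∀ β ∈ Ψ, α + β ∈ R.realRoots → α + β ∈ Ψ

/-! ### Regular subalgebras -/

/-- A regular subalgebra is an `𝔥`-invariant Lie subalgebra. -/
def IsRegular (R : Realization A 𝔥) (s : LieSubalgebra ℂ R.KacMoodyAlgebra) : Prop :=
  ∀ h : 𝔥, ∀ x ∈ s, ⁅R.cartan h, x⁆ ∈ s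

/-- `Δ(𝔰) = {α ∈ Δ | 𝔤_α ∩ 𝔰 ≠ 0}`. -/
def rootsOf (R : Realization A 𝔥) (s : LieSubalgebra ℂ R.KacMoodyAlgebra) :
    Set (Module.Dual ℂ 𝔥) :=
  {α | α ∈ R.roots ∧ R.rootSpace α ⊓ s.toSubmodule ≠ ⊥}

/-- `Δ(𝔰)^re`. -/
def realRootsOf (R : Realization A 𝔥) (s : LieSubalgebra ℂ R.KacMoodyAlgebra) :
    Set (Module.Dual ℂ 𝔥) :=
  R.realRoots ∩ R.rootsOf s

/-- `𝔰` is symmetric if `Δ(𝔰) = -Δ(𝔰)`. -/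
def IsSymmetric (R : Realization A 𝔥) (s : LieSubalgebra ℂ R.KacMoodyAlgebra) : Prop :=
  R.rootsOf s = {α | -α ∈ R.rootsOf s}

/-! ### The coroot of a real root does not depend on the presentation -/

/-- The graph of the map `αᵢ^∨ ↦ dᵢ⁻¹ αᵢ` on the span of the simple coroots. -/
def corootGraph (R : Realization A 𝔥) (d : I → ℂ) : Submodule ℂ (𝔥 × Module.Dual ℂ 𝔥) :=
  Submodule.span ℂ (Set.range fun i => (R.simpleCoroot i, (d i)⁻¹ • R.simpleRoot i))

theorem corootGraph_pairing (R : Realization A 𝔥) {d : I → ℂ} (hd : ∀ i, d i ≠ 0)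
    (hA : ∀ i j, d i * (A i j : ℂ) = d j * (A j i : ℂ)) {p : 𝔥 × Module.Dual ℂ 𝔥}
    (hp : p ∈ R.corootGraph d) (j : I) :
    p.2 (R.simpleCoroot j) = (d j)⁻¹ * R.simpleRoot j p.1 := by
  induction hp using Submodule.span_induction with
  | mem p hp =>
    obtain ⟨i, rfl⟩ := hp
    have h1 := hd i
    have h2 := hd j
    have h3 := hA i j
    simp only [LinearMap.smul_apply, simpleRoot_simpleCoroot, smul_eq_mul]
    field_simp
    linear_combination -h3
  | zero => simp
  | add x y _ _ hx hy => simp [hx, hy, mul_add]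
  | smul c x _ hx =>
    simp only [Prod.smul_snd, Prod.smul_fst, LinearMap.smul_apply, map_smul, hx, smul_eq_mul]
    ring

theorem corootGraph_weyl (R : Realization A 𝔥) (hdiag : ∀ i, A i i = 2) {d : I → ℂ}
    (hd : ∀ i, d i ≠ 0) (hA : ∀ i j, d i * (A i j : ℂ) = d j * (A j i : ℂ))
    {w : 𝔥 ≃ₗ[ℂ] 𝔥} (hw : w ∈ R.weylGroup) :
    ∀ p ∈ R.corootGraph d,
      (w p.1, p.2 ∘ₗ (w⁻¹ : 𝔥 ≃ₗ[ℂ] 𝔥).toLinearMap) ∈ R.corootGraph d := by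
  have key : ∀ (s t : 𝔥 ≃ₗ[ℂ] 𝔥) (i : I),
      (∀ h, s h = h - R.simpleRoot i h • R.simpleCoroot i) →
      (∀ h, t h = h - R.simpleRoot i h • R.simpleCoroot i) →
      ∀ p ∈ R.corootGraph d, (s p.1, p.2 ∘ₗ t.toLinearMap) ∈ R.corootGraph d := by
    intro s t i hs ht p hp
    have h1 : (s p.1, p.2 ∘ₗ t.toLinearMap) =
        p - R.simpleRoot i p.1 • (R.simpleCoroot i, (d i)⁻¹ • R.simpleRoot i) := by
      ext x
      · simp [hs]
      · simp only [LinearMap.comp_apply, LinearEquiv.coe_coe, ht, map_sub, map_smul, smul_eq_mul,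
          R.corootGraph_pairing hd hA hp, Prod.snd_sub, Prod.smul_snd, LinearMap.sub_apply,
          LinearMap.smul_apply]
        ring
    rw [h1]
    exact sub_mem hp (Submodule.smul_mem _ _ (Submodule.subset_span ⟨i, rfl⟩))
  have hinv : ∀ (s : 𝔥 ≃ₗ[ℂ] 𝔥) (i : I),
      (∀ h, s h = h - R.simpleRoot i h • R.simpleCoroot i) → s⁻¹ = s := by
    intro s i hs
    refine inv_eq_of_mul_eq_one_left ?_
    ext h
    simp only [LinearEquiv.mul_apply, hs, map_sub, map_smul, smul_eq_mul,
      simpleRoot_simpleCoroot, hdiag, LinearEquiv.coe_one, id]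
    module
  induction hw using Subgroup.closure_induction'' with
  | one => exact fun p hp => hp
  | mem s hs =>
    obtain ⟨i, hi⟩ := hs
    exact key s _ i hi (by rw [hinv s i hi]; exact hi)
  | inv_mem s hs =>
    obtain ⟨i, hi⟩ := hs
    rw [inv_inv]
    exact key _ s i (by rw [hinv s i hi]; exact hi) hi
  | mul x y _ _ hx hy =>
    intro p hp
    have := hx _ (hy p hp)
    rw [mul_inv_rev]
    exact this

theorem coroot_eq (R : Realization A 𝔥) (hA : IsGCM A) (hS : IsSymmetrizable A)
    {α : Module.Dual ℂ 𝔥} {p : (𝔥 ≃ₗ[ℂ] 𝔥) × I} (hp : R.Presents α p) :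
    R.coroot α = p.1 (R.simpleCoroot p.2) := by
  have hα : ∃ p, R.Presents α p := ⟨p, hp⟩
  rw [coroot, dif_pos hα]
  obtain ⟨hq1, hq2⟩ := hα.choose_spec
  obtain ⟨hp1, hp2⟩ := hp
  generalize hα.choose = q at hq1 hq2
  obtain ⟨d, hd, hd'⟩ := hS
  have mem : ∀ r : (𝔥 ≃ₗ[ℂ] 𝔥) × I, r.1 ∈ R.weylGroup →
      α = R.simpleRoot r.2 ∘ₗ (r.1⁻¹ : 𝔥 ≃ₗ[ℂ] 𝔥).toLinearMap →
      (d r.2 • r.1 (R.simpleCoroot r.2), α) ∈ R.corootGraph d := by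
    intro r hr hr'
    have h1 := R.corootGraph_weyl hA.diag hd hd' hr _
      (Submodule.smul_mem _ (d r.2) (Submodule.subset_span ⟨r.2, rfl⟩))
    convert h1 using 2
    · simp
    · rw [hr']
      simp [smul_smul, hd]
  have inj : ∀ x, (x, (0 : Module.Dual ℂ 𝔥)) ∈ R.corootGraph d → x = 0 := by
    intro x hx
    obtain ⟨c, hc⟩ := (Submodule.mem_span_range_iff_exists_fun ℂ).1 hx
    have h2 := congrArg Prod.snd hc
    have h1 := congrArg Prod.fst hc
    simp only [Prod.snd_sum, Prod.fst_sum, Prod.smul_mk, smul_smul] at h1 h2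
    have h3 := Fintype.linearIndependent_iff.1 R.linearIndependent_simpleRoot _ h2
    rw [← h1]
    refine Finset.sum_eq_zero fun i _ => ?_
    have := (mul_eq_zero.1 (h3 i)).resolve_right (inv_ne_zero (hd i))
    rw [this, zero_smul]
  have h0 := sub_mem (mem q hq1 hq2) (mem p hp1 hp2)
  rw [Prod.mk_sub_mk, sub_self] at h0
  have h1 := sub_eq_zero.1 (inj _ h0)
  have two : ∀ r : (𝔥 ≃ₗ[ℂ] 𝔥) × I,
      α = R.simpleRoot r.2 ∘ₗ (r.1⁻¹ : 𝔥 ≃ₗ[ℂ] 𝔥).toLinearMap →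
      α (r.1 (R.simpleCoroot r.2)) = 2 := by
    intro r hr
    have h2 : (r.1⁻¹ : 𝔥 ≃ₗ[ℂ] 𝔥) (r.1 (R.simpleCoroot r.2)) = R.simpleCoroot r.2 :=
      r.1.symm_apply_apply _
    rw [hr, LinearMap.comp_apply, LinearEquiv.coe_coe, h2, simpleRoot_simpleCoroot, hA.diag]
    norm_num
  have h2 := congrArg α h1
  rw [map_smul, map_smul, two q hq2, two p hp2, smul_eq_mul, smul_eq_mul] at h2
  have h3 : d q.2 = d p.2 := mul_right_cancel₀ two_ne_zero h2
  rw [h3] at h1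
  exact smul_right_injective 𝔥 (hd p.2) h1

end

end Realization

/-! A real root space is at most one-dimensional, so a real root `α` of `𝔰` has its whole root space
in `𝔰`; by symmetry the same holds for `-α`. Thus `𝔰` contains the elements `e`, `f` of an
`𝔰𝔩₂`-triple of `α`, both locally ad-nilpotent on `𝔤`. Let `0 ≠ x ∈ 𝔤_β ∩ 𝔰` and `m = β(α^∨) ∈ ℤ`.
For `k ≥ 0` the element `(ad e)^k x` lies in `𝔰` and has weight `β + kα`; the point is that it is
non-zero. On a weight space of weight `M ≥ k` the operator `e^k f^k` is injective
(`eq_zero_of_ad_e_pow_ad_f_pow`). If `m + k ≤ 0`, its mirror image shows that `f^k e^k x ≠ 0`. If `m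
+ k > 0` and `β + kα` is a root with root vector `y`, then `f^k y` is a multiple of `x` because
`𝔤_β` is a line, and `e^k f^k y ≠ 0` forces `e^k x ≠ 0`. Negative `k` is handled by exchanging `e`
and `f`. This gives the string; the sum is the case `k = 1` and the reflection the case `k = -m`.
The rest establishes the facts about `𝔤(A)` used here. The Serre elements generate ideals avoiding
`𝔥`, hence vanish in `𝔤(A)`, and so `eᵢ`, `fᵢ` are locally ad-nilpotent. Products of exponentials
then lift the Weyl group to injective endomorphisms, which transport the triple and the equality
`𝔤_{αᵢ} = ℂeᵢ` from simple roots to real roots. -/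

/-! ### Locally nilpotent `𝔰𝔩₂`-theory. -/

/-- The commutation relations of `𝔰𝔩₂`; the elements may vanish. -/
structure IsSl2Relations {L : Type*} [LieRing L] [LieAlgebra ℂ L] (h e f : L) : Prop where
  lie_e_f : ⁅e, f⁆ = h
  lie_h_e : ⁅h, e⁆ = (2 : ℂ) • e
  lie_h_f : ⁅h, f⁆ = (-2 : ℂ) • f

namespace IsSl2Relations

open LieAlgebra

variable {L : Type*} [LieRing L] [LieAlgebra ℂ L] {h e f : L}

theorem symm (t : IsSl2Relations h e f) : IsSl2Relations (-h) f e where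
  lie_e_f := by rw [← t.lie_e_f, lie_skew]
  lie_h_e := by rw [neg_lie, t.lie_h_f]; module
  lie_h_f := by rw [neg_lie, t.lie_h_e]; module

theorem lie_h_lie_f (t : IsSl2Relations h e f) {y : L} {M : ℂ} (hy : ⁅h, y⁆ = M • y) :
    ⁅h, ⁅f, y⁆⁆ = (M - 2) • ⁅f, y⁆ := by
  rw [leibniz_lie, t.lie_h_f, hy, smul_lie, lie_smul]
  module

theorem lie_h_lie_e (t : IsSl2Relations h e f) {y : L} {M : ℂ} (hy : ⁅h, y⁆ = M • y) :
    ⁅h, ⁅e, y⁆⁆ = (M + 2) • ⁅e, y⁆ := by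
  rw [leibniz_lie, t.lie_h_e, hy, smul_lie, lie_smul]
  module

theorem lie_h_ad_f_pow (t : IsSl2Relations h e f) {y : L} {M : ℂ} (hy : ⁅h, y⁆ = M • y) (k : ℕ) :
    ⁅h, (ad ℂ L f ^ k) y⁆ = (M - 2 * k) • (ad ℂ L f ^ k) y := by
  induction k with
  | zero => simpa using hy
  | succ k ih =>
    rw [pow_succ', Module.End.mul_apply, ad_apply, t.lie_h_lie_f ih]
    push_cast
    congr 1
    ring

/-- Moving `e` to the right past `k` factors `f` produces the weights `M - 2i` for `1 ≤ i ≤ k`, with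
sum `-k (k + 1 - M)`. Since `y` need not be a highest weight vector, the term `⁅e, ⁅f, y⁆⁆` remains.
-/
theorem lie_e_ad_f_pow_succ (t : IsSl2Relations h e f) {y : L} {M : ℂ} (hy : ⁅h, y⁆ = M • y)
    (k : ℕ) :
    ⁅e, (ad ℂ L f ^ (k + 1)) y⁆ = (ad ℂ L f ^ k) (⁅e, ⁅f, y⁆⁆ - ((k : ℂ) * (k + 1 - M)) • y) := by
  induction k with
  | zero => simp
  | succ k ih =>
    rw [pow_succ', Module.End.mul_apply, ad_apply, leibniz_lie, t.lie_e_f, ih,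
      t.lie_h_ad_f_pow hy, map_sub, map_sub, lie_sub, map_smul, map_smul, lie_smul,
      ← ad_apply ℂ L f, ← ad_apply ℂ L f ((ad ℂ L f ^ k) y), ← Module.End.mul_apply,
      ← Module.End.mul_apply, ← pow_succ']
    push_cast
    module

/-- An eigenvector of `ef` whose eigenvalue belongs to no finite-dimensional representation
vanishes. -/
theorem eq_zero_of_lie_e_lie_f_eq (t : IsSl2Relations h e f) (he : LieSubalgebra.engel ℂ e = ⊤)
    {y : L} {M : ℕ} (hy : ⁅h, y⁆ = (M : ℂ) • y) {j : ℕ} (hj : j < M)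
    (hef : ⁅e, ⁅f, y⁆⁆ = ((j : ℂ) * (j + 1 - M)) • y) : y = 0 := by
  obtain ⟨n, hn⟩ := (LieSubalgebra.mem_engel_iff ℂ e y).1 (he ▸ LieSubalgebra.mem_top y)
  induction n with
  | zero => simpa using hn
  | succ n ih =>
    refine ih ?_
    -- The mirrored formula evaluates `f e^(n+1) y = 0` as a scalar times `e^n y`. The scalar
    -- factors as `-(j + 1 + n)(n + M - j)`, non-zero because `j < M`, so the nilpotency exponent
    -- drops to `n`.
    have h1 := t.symm.lie_e_ad_f_pow_succ (y := y) (M := -M) (by rw [neg_lie, hy, neg_smul]) n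
    have h2 : ⁅f, ⁅e, y⁆⁆ = ((j : ℂ) * (j + 1 - M) - M) • y := by
      have h3 := leibniz_lie e f y
      rw [t.lie_e_f, hy, hef] at h3
      rw [sub_smul, h3]
      abel
    rw [hn, lie_zero, h2, ← sub_smul, map_smul] at h1
    refine (smul_eq_zero.1 h1.symm).resolve_left ?_
    have h4 : (j : ℂ) * (j + 1 - M) - M - n * (n + 1 - -M) =
        -((j + 1 + n : ℕ) : ℂ) * ((n + M - j : ℤ) : ℂ) := by
      push_cast
      ring
    rw [h4]
    refine mul_ne_zero (neg_ne_zero.2 ?_) ?_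
    · exact_mod_cast (by omega : j + 1 + n ≠ 0)
    · exact_mod_cast (by omega : (n + M - j : ℤ) ≠ 0)

/-- In a weight space of weight `M ≥ k`, the operator `e ^ k f ^ k` is injective. -/
theorem eq_zero_of_ad_e_pow_ad_f_pow (t : IsSl2Relations h e f)
    (he : LieSubalgebra.engel ℂ e = ⊤) {M k : ℕ} (hk : k ≤ M) {y : L}
    (hy : ⁅h, y⁆ = (M : ℂ) • y) (h0 : (ad ℂ L e ^ k) ((ad ℂ L f ^ k) y) = 0) : y = 0 := by
  induction k generalizing y with
  | zero => simpa using h0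
  | succ k ih =>
    rw [pow_succ, Module.End.mul_apply, ad_apply, t.lie_e_ad_f_pow_succ hy] at h0
    -- `e^(k+1) f^(k+1)` is `e^k f^k` applied after `ef - k(k + 1 - M)`, which preserves the weight;
    -- by induction only an eigenvector of `ef` could be killed.
    have h1 := ih (by omega) (y := ⁅e, ⁅f, y⁆⁆ - ((k : ℂ) * (k + 1 - M)) • y) ?_ h0
    · exact t.eq_zero_of_lie_e_lie_f_eq he hy (by omega : k < M) (sub_eq_zero.1 h1)
    · rw [lie_sub, lie_smul, hy, t.lie_h_lie_e (t.lie_h_lie_f hy)]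
      module

end IsSl2Relations

/-! ### The exponential of a locally ad-nilpotent element -/

section LocallyNilpotent

open LieAlgebra
open scoped Nat

variable {L : Type*} [LieRing L] [LieAlgebra ℂ L] {x : L}

theorem exists_ad_pow_eq_zero (hx : LieSubalgebra.engel ℂ x = ⊤) (y : L) :
    ∃ N, ∀ n, N ≤ n → (ad ℂ L x ^ n) y = 0 := by
  obtain ⟨N, hN⟩ := (LieSubalgebra.mem_engel_iff ℂ x y).1 (hx ▸ LieSubalgebra.mem_top y)
  exact ⟨N, fun n hn => Module.End.pow_map_zero_of_le hn hN⟩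

/-- The series `∑ (ad x) ^ n y / n!`, a finite sum when `x` is locally ad-nilpotent. -/
noncomputable def expAdFun (x y : L) : L := ∑ᶠ n : ℕ, ((n ! : ℂ))⁻¹ • (ad ℂ L x ^ n) y

theorem expAdFun_eq_sum {y : L} {N : ℕ} (hN : ∀ n, N ≤ n → (ad ℂ L x ^ n) y = 0) :
    expAdFun x y = ∑ n ∈ Finset.range N, ((n ! : ℂ))⁻¹ • (ad ℂ L x ^ n) y := by
  refine finsum_eq_sum_of_support_subset _ fun n hn => ?_
  by_contra h
  simp only [Finset.coe_range, Set.mem_Iio, not_lt] at h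
  exact hn (by simp [hN n h])

theorem expAdFun_lie (hx : LieSubalgebra.engel ℂ x = ⊤) (y z : L) :
    expAdFun x ⁅y, z⁆ = ⁅expAdFun x y, expAdFun x z⁆ := by
  obtain ⟨a, ha⟩ := exists_ad_pow_eq_zero hx y
  obtain ⟨b, hb⟩ := exists_ad_pow_eq_zero hx z
  have hab : ∀ p : ℕ × ℕ, a + b ≤ p.1 + p.2 → ⁅(ad ℂ L x ^ p.1) y, (ad ℂ L x ^ p.2) z⁆ = 0 := by
    intro p hp
    rcases le_or_gt a p.1 with h | h
    · rw [ha _ h, zero_lie]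
    · rw [hb p.2 (by omega), lie_zero]
  have hyz : ∀ n, a + b ≤ n → (ad ℂ L x ^ n) ⁅y, z⁆ = 0 := by
    intro n hn
    rw [ad_pow_lie]
    refine Finset.sum_eq_zero fun p hp => ?_
    rw [hab p (by rw [Finset.HasAntidiagonal.mem_antidiagonal.1 hp]; exact hn), smul_zero]
  set N := a + b
  have hterm : ∀ n, ((n ! : ℂ))⁻¹ • (ad ℂ L x ^ n) ⁅y, z⁆ =
      ∑ p ∈ Finset.HasAntidiagonal.antidiagonal n,
        ⁅((p.1 ! : ℂ))⁻¹ • (ad ℂ L x ^ p.1) y, ((p.2 ! : ℂ))⁻¹ • (ad ℂ L x ^ p.2) z⁆ := by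
    intro n
    rw [ad_pow_lie, Finset.smul_sum]
    refine Finset.sum_congr rfl fun p hp => ?_
    have hp' := Finset.HasAntidiagonal.mem_antidiagonal.1 hp
    rw [smul_lie, lie_smul, smul_smul, ← Nat.cast_smul_eq_nsmul ℂ, smul_smul]
    congr 1
    have h1 := Nat.add_choose_mul_factorial_mul_factorial p.1 p.2
    rw [hp', ← Nat.choose_symm_of_eq_add hp'.symm] at h1
    have h2 : (n ! : ℂ) ≠ 0 := by exact_mod_cast n.factorial_ne_zero
    have h3 : (p.1 ! : ℂ) ≠ 0 := by exact_mod_cast p.1.factorial_ne_zero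
    have h4 : (p.2 ! : ℂ) ≠ 0 := by exact_mod_cast p.2.factorial_ne_zero
    have h5 : (n.choose p.1 : ℂ) * p.1 ! * p.2 ! = n ! := by exact_mod_cast h1
    field_simp
    linear_combination h5
  -- The square `p.1, p.2 < N` is regrouped along antidiagonals of index below `2 * N`. Antidiagonal
  -- terms outside the square have total degree at least `N = a + b` and vanish.
  rw [expAdFun_eq_sum (N := 2 * N) fun n hn => hyz n (by omega),
    expAdFun_eq_sum (N := N) fun n hn => ha n (by omega),
    expAdFun_eq_sum (N := N) fun n hn => hb n (by omega), sum_lie_sum,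
    ← Finset.sum_product', ← Finset.sum_fiberwise_of_maps_to (t := Finset.range (2 * N))
      (g := fun p : ℕ × ℕ => p.1 + p.2)]
  · refine Finset.sum_congr rfl fun n hn => ?_
    rw [hterm]
    symm
    refine Finset.sum_subset (fun p hp => ?_) fun p hp hp' => ?_
    · simpa using (Finset.mem_filter.1 hp).2
    · rw [smul_lie, lie_smul, hab p, smul_zero, smul_zero]
      simp only [Finset.mem_filter, Finset.mem_product, Finset.mem_range, not_and] at hp hp'
      have := Finset.HasAntidiagonal.mem_antidiagonal.1 hp
      by_contra h
      exact hp' ⟨by omega, by omega⟩ this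
  · intro p hp
    simp only [Finset.mem_product, Finset.mem_range] at hp ⊢
    omega

/-- The exponential of `ad x` for a locally ad-nilpotent element `x`. -/
noncomputable def expAd (x : L) (hx : LieSubalgebra.engel ℂ x = ⊤) : L →ₗ⁅ℂ⁆ L where
  toFun := expAdFun x
  map_add' y z := by
    obtain ⟨a, ha⟩ := exists_ad_pow_eq_zero hx y
    obtain ⟨b, hb⟩ := exists_ad_pow_eq_zero hx z
    rw [expAdFun_eq_sum (N := max a b) fun n hn => ha n (by omega),
      expAdFun_eq_sum (N := max a b) fun n hn => hb n (by omega),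
      expAdFun_eq_sum (N := max a b) fun n hn => by rw [map_add, ha n (by omega), hb n (by omega),
        add_zero], ← Finset.sum_add_distrib]
    simp
  map_smul' c y := by
    obtain ⟨a, ha⟩ := exists_ad_pow_eq_zero hx y
    rw [expAdFun_eq_sum ha, expAdFun_eq_sum (N := a) fun n hn => by rw [map_smul, ha n hn,
        smul_zero], RingHom.id_apply, Finset.smul_sum]
    exact Finset.sum_congr rfl fun n _ => by rw [map_smul, smul_comm]
  map_lie' := expAdFun_lie hx _ _

theorem expAd_of_lie_eq_zero (hx : LieSubalgebra.engel ℂ x = ⊤) {y : L} (h1 : ⁅x, y⁆ = 0) :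
    expAd x hx y = y := by
  have h : ∀ n, 1 ≤ n → (ad ℂ L x ^ n) y = 0 := fun n hn =>
    Module.End.pow_map_zero_of_le hn (by simpa using h1)
  exact (expAdFun_eq_sum h).trans (by simp)

theorem expAd_of_lie_lie_eq_zero (hx : LieSubalgebra.engel ℂ x = ⊤) {y : L}
    (h2 : ⁅x, ⁅x, y⁆⁆ = 0) : expAd x hx y = y + ⁅x, y⁆ := by
  have h : ∀ n, 2 ≤ n → (ad ℂ L x ^ n) y = 0 := fun n hn =>
    Module.End.pow_map_zero_of_le hn (by simpa [pow_succ] using h2)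
  exact (expAdFun_eq_sum h).trans (by simp [Finset.sum_range_succ])

theorem expAd_of_lie_lie_lie_eq_zero (hx : LieSubalgebra.engel ℂ x = ⊤) {y : L}
    (h3 : ⁅x, ⁅x, ⁅x, y⁆⁆⁆ = 0) :
    expAd x hx y = y + ⁅x, y⁆ + (2 : ℂ)⁻¹ • ⁅x, ⁅x, y⁆⁆ := by
  have h : ∀ n, 3 ≤ n → (ad ℂ L x ^ n) y = 0 := fun n hn =>
    Module.End.pow_map_zero_of_le hn (by simpa [pow_succ] using h3)
  exact (expAdFun_eq_sum h).trans (by simp [Finset.sum_range_succ, pow_succ, Nat.factorial])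

/-- The kernel is stable under `ad x`. Induction on the nilpotency exponent gives `⁅x, y⁆ = 0` for
`y` in the kernel, and then the exponential fixes `y`. -/
theorem expAd_injective (hx : LieSubalgebra.engel ℂ x = ⊤) : Function.Injective (expAd x hx) := by
  rw [injective_iff_map_eq_zero]
  intro y hy
  obtain ⟨n, hn⟩ := (LieSubalgebra.mem_engel_iff ℂ x y).1 (hx ▸ LieSubalgebra.mem_top y)
  induction n generalizing y with
  | zero => simpa using hn
  | succ n ih =>
    have h1 : ⁅x, y⁆ = 0 := by
      refine ih ⁅x, y⁆ ?_ (by rwa [pow_succ, Module.End.mul_apply] at hn)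
      rw [LieHom.map_lie, hy, lie_zero]
    rwa [expAd_of_lie_eq_zero hx h1] at hy

theorem engel_eq_top_of_injective {L' : Type*} [LieRing L'] [LieAlgebra ℂ L'] (g : L →ₗ⁅ℂ⁆ L')
    (hg : Function.Injective g) (hx : LieSubalgebra.engel ℂ (g x) = ⊤) :
    LieSubalgebra.engel ℂ x = ⊤ := by
  refine eq_top_iff.2 fun y _ => (LieSubalgebra.mem_engel_iff ℂ x y).2 ?_
  obtain ⟨n, hn⟩ := (LieSubalgebra.mem_engel_iff ℂ (g x) (g y)).1
    (hx ▸ LieSubalgebra.mem_top (g y))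
  refine ⟨n, hg ?_⟩
  rw [map_zero, ← hn]
  clear hn
  induction n with
  | zero => simp only [pow_zero, Module.End.one_apply]
  | succ n ih =>
    rw [pow_succ', pow_succ', Module.End.mul_apply, Module.End.mul_apply, ad_apply, ad_apply,
      LieHom.map_lie, ih]

theorem engel_smul_eq_top (hx : LieSubalgebra.engel ℂ x = ⊤) (c : ℂ) :
    LieSubalgebra.engel ℂ (c • x) = ⊤ := by
  refine eq_top_iff.2 fun y _ => (LieSubalgebra.mem_engel_iff ℂ _ y).2 ?_
  obtain ⟨n, hn⟩ := exists_ad_pow_eq_zero hx y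
  exact ⟨n, by rw [map_smul, smul_pow, LinearMap.smul_apply, hn n le_rfl, smul_zero]⟩

end LocallyNilpotent

/-! ### Chevalley generators, singular vectors and triangular decomposition. -/

namespace Realization

open LieAlgebra

variable {I : Type*} [Fintype I] {A : Matrix I I ℤ} {𝔥 : Type*} [AddCommGroup 𝔥] [Module ℂ 𝔥]

/-- A functional vanishing on the range of the joint evaluation map would be a linear relation
between the simple roots. The elements `δ` obtained here grade the algebra by prescribed degrees. -/
theorem exists_simpleRoot_eq (R : Realization A 𝔥) (c : I → ℂ) :
    ∃ δ : 𝔥, ∀ i, R.simpleRoot i δ = c i := by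
  classical
  suffices h : LinearMap.range (LinearMap.pi R.simpleRoot) = ⊤ by
    obtain ⟨δ, hδ⟩ := LinearMap.range_eq_top.1 h c
    exact ⟨δ, fun i => congrFun hδ i⟩
  by_contra h
  obtain ⟨ξ, hξ0, hξ⟩ := Submodule.exists_dual_map_eq_bot_of_lt_top (lt_top_iff_ne_top.2 h)
    inferInstance
  refine hξ0 ?_
  have h1 : ∑ i, ξ (Pi.single i 1) • R.simpleRoot i = 0 := by
    ext x
    have h2 : ξ (LinearMap.pi R.simpleRoot x) = 0 := by
      rw [← Submodule.mem_bot ℂ, ← hξ]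
      exact Submodule.mem_map_of_mem (LinearMap.mem_range_self _ x)
    rw [← LinearMap.sum_single_apply (φ := fun _ => ℂ) (LinearMap.pi R.simpleRoot x), map_sum] at h2
    rw [LinearMap.zero_apply, ← h2, LinearMap.sum_apply]
    refine Finset.sum_congr rfl fun i _ => ?_
    rw [LinearMap.smul_apply, smul_eq_mul, mul_comm, ← smul_eq_mul, ← map_smul]
    congr 1
    ext j
    simp [Pi.single_apply]
  have h3 := Fintype.linearIndependent_iff.1 R.linearIndependent_simpleRoot _ h1
  ext i
  simpa using h3 i

/-- Elements `eᵢ`, `fᵢ` and a linear map from `𝔥` that satisfy the defining relations of `𝔤̃(A)` and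
generate the Lie algebra. -/
structure ChevalleyGenerators (R : Realization A 𝔥) (L : Type*) [LieRing L] [LieAlgebra ℂ L] where
  H : 𝔥 →ₗ[ℂ] L
  E : I → L
  F : I → L
  lie_H_H : ∀ x y, ⁅H x, H y⁆ = 0
  lie_E_F_same : ∀ i, ⁅E i, F i⁆ = H (R.simpleCoroot i)
  lie_E_F_ne : ∀ i j, i ≠ j → ⁅E i, F j⁆ = 0
  lie_H_E : ∀ x i, ⁅H x, E i⁆ = R.simpleRoot i x • E i
  lie_H_F : ∀ x i, ⁅H x, F i⁆ = -(R.simpleRoot i x • F i)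
  generates : ∀ K : LieSubalgebra ℂ L, (∀ i, E i ∈ K) → (∀ i, F i ∈ K) → (∀ x, H x ∈ K) → K = ⊤

namespace ChevalleyGenerators

variable {R : Realization A 𝔥} {L : Type*} [LieRing L] [LieAlgebra ℂ L]

/-- The generators with the roles of `eᵢ` and `fᵢ` exchanged. -/
def opposite (g : R.ChevalleyGenerators L) : R.ChevalleyGenerators L where
  H := -g.H
  E := g.F
  F := g.E
  lie_H_H x y := by simp [g.lie_H_H]
  lie_E_F_same i := by rw [← lie_skew, g.lie_E_F_same, LinearMap.neg_apply]
  lie_E_F_ne i j hij := by rw [← lie_skew, g.lie_E_F_ne j i hij.symm, neg_zero]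
  lie_H_E x i := by simp [g.lie_H_F]
  lie_H_F x i := by simp [g.lie_H_E]
  generates K hE hF hH := g.generates K hF hE fun x => by simpa using hH x

/-- The images of the generators under a surjective homomorphism. -/
def map (g : R.ChevalleyGenerators L) {L' : Type*} [LieRing L'] [LieAlgebra ℂ L']
    (π : L →ₗ⁅ℂ⁆ L') (hπ : Function.Surjective π) : R.ChevalleyGenerators L' where
  H := (π : L →ₗ[ℂ] L') ∘ₗ g.H
  E i := π (g.E i)
  F i := π (g.F i)
  lie_H_H x y := by simp [← LieHom.map_lie, g.lie_H_H]
  lie_E_F_same i := by simp [← LieHom.map_lie, g.lie_E_F_same]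
  lie_E_F_ne i j hij := by simp [← LieHom.map_lie, g.lie_E_F_ne i j hij]
  lie_H_E x i := by simp [← LieHom.map_lie, g.lie_H_E]
  lie_H_F x i := by simp [← LieHom.map_lie, g.lie_H_F]
  generates K hE hF hH := by
    have h := g.generates (K.comap π) hE hF hH
    refine eq_top_iff.2 fun y _ => ?_
    obtain ⟨x, rfl⟩ := hπ y
    exact (h ▸ LieSubalgebra.mem_top x : x ∈ K.comap π)

variable (g : R.ChevalleyGenerators L)

theorem isSl2Relations (hA : IsGCM A) (i : I) :
    IsSl2Relations (g.H (R.simpleCoroot i)) (g.E i) (g.F i) where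
  lie_e_f := g.lie_E_F_same i
  lie_h_e := by rw [g.lie_H_E, R.simpleRoot_simpleCoroot, hA.diag]; norm_num
  lie_h_f := by rw [g.lie_H_F, R.simpleRoot_simpleCoroot, hA.diag]; norm_num

/-- A subspace that is stable under the generators is an ideal. -/
theorem lie_mem_of_stable {U : Submodule ℂ L} (hE : ∀ i, ∀ u ∈ U, ⁅g.E i, u⁆ ∈ U)
    (hF : ∀ i, ∀ u ∈ U, ⁅g.F i, u⁆ ∈ U) (hH : ∀ x, ∀ u ∈ U, ⁅g.H x, u⁆ ∈ U) (x : L) {u : L}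
    (hu : u ∈ U) : ⁅x, u⁆ ∈ U := by
  let K : LieSubalgebra ℂ L :=
    { carrier := {x | ∀ u ∈ U, ⁅x, u⁆ ∈ U}
      add_mem' := fun {a b} ha hb u hu => by rw [add_lie]; exact add_mem (ha u hu) (hb u hu)
      zero_mem' := fun u _ => by rw [zero_lie]; exact zero_mem _
      smul_mem' := fun c a ha u hu => by rw [smul_lie]; exact U.smul_mem c (ha u hu)
      lie_mem' := fun {a b} ha hb u hu => by
        rw [lie_lie]; exact sub_mem (ha _ (hb u hu)) (hb _ (ha u hu)) }
  have hK : K = ⊤ := g.generates K hE hF hH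
  exact (hK ▸ LieSubalgebra.mem_top x : x ∈ K) u hu

/-! ### Gradings -/

/-- The sum of the eigenspaces of `ad δ` with integral eigenvalue in `S`. -/
def degreeSum (δ : 𝔥) (S : Set ℤ) : Submodule ℂ L :=
  ⨆ n ∈ S, Module.End.eigenspace (ad ℂ L (g.H δ)) (n : ℂ)

theorem mem_degreeSum {δ : 𝔥} {S : Set ℤ} {n : ℤ} (hn : n ∈ S) {x : L}
    (hx : ⁅g.H δ, x⁆ = (n : ℂ) • x) : x ∈ g.degreeSum δ S :=
  Submodule.mem_iSup_of_mem n <| Submodule.mem_iSup_of_mem hn <|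
    Module.End.mem_eigenspace_iff.2 hx

theorem degreeSum_mono {δ : 𝔥} {S T : Set ℤ} (h : S ⊆ T) : g.degreeSum δ S ≤ g.degreeSum δ T :=
  biSup_mono h

/-- Eigenspaces for different eigenvalues are independent, in any dimension. Degree counts based on
this replace any directness statement for the triangular decomposition. -/
theorem eq_zero_of_mem_degreeSum {δ : 𝔥} {S : Set ℤ} {n : ℤ} (hn : n ∉ S) {x : L}
    (hx : x ∈ g.degreeSum δ S) (hx' : ⁅g.H δ, x⁆ = (n : ℂ) • x) : x = 0 := by
  have h := ((Module.End.eigenspaces_iSupIndep (ad ℂ L (g.H δ))).comp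
    (Int.cast_injective (α := ℂ))).disjoint_biSup hn
  exact (Submodule.disjoint_def.1 h) x (Module.End.mem_eigenspace_iff.2 hx') hx

theorem lie_mem_degreeSum {δ : 𝔥} {S T U : Set ℤ} (h : ∀ m ∈ S, ∀ n ∈ T, m + n ∈ U) {x y : L}
    (hx : x ∈ g.degreeSum δ S) (hy : y ∈ g.degreeSum δ T) : ⁅x, y⁆ ∈ g.degreeSum δ U := by
  induction hx using Submodule.iSup_induction' with
  | zero => rw [zero_lie]; exact zero_mem _
  | add a b _ _ ha hb => rw [add_lie]; exact add_mem ha hb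
  | mem m x hx =>
    by_cases hm : m ∈ S
    · rw [iSup_pos hm, Module.End.mem_eigenspace_iff, ad_apply] at hx
      induction hy using Submodule.iSup_induction' with
      | zero => rw [lie_zero]; exact zero_mem _
      | add a b _ _ ha hb => rw [lie_add]; exact add_mem ha hb
      | mem n y hy =>
        by_cases hn : n ∈ T
        · rw [iSup_pos hn, Module.End.mem_eigenspace_iff, ad_apply] at hy
          refine g.mem_degreeSum (h m hm n hn) ?_
          rw [leibniz_lie, hx, hy, smul_lie, lie_smul]
          push_cast
          module
        · rw [iSup_neg hn, Submodule.mem_bot] at hy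
          rw [hy, lie_zero]; exact zero_mem _
    · rw [iSup_neg hm, Submodule.mem_bot] at hx
      rw [hx, zero_lie]; exact zero_mem _

/-! ### Singular vectors generate ideals that avoid `𝔥` -/

/-- The elements `[f_{i₁}, [f_{i₂}, … , [f_{iₙ}, y]]]`, with their weights. -/
inductive LoweringWord (y : L) (μ : Module.Dual ℂ 𝔥) : Module.Dual ℂ 𝔥 → L → Prop
  | base : LoweringWord y μ μ y
  | step {ν : Module.Dual ℂ 𝔥} {z : L} (k : I) (h : LoweringWord y μ ν z) :
      LoweringWord y μ (ν - R.simpleRoot k) ⁅g.F k, z⁆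

theorem LoweringWord.lie_H {g : R.ChevalleyGenerators L} {y : L} {μ : Module.Dual ℂ 𝔥}
    (hy : ∀ x, ⁅g.H x, y⁆ = μ x • y) {ν : Module.Dual ℂ 𝔥} {z : L}
    (h : g.LoweringWord y μ ν z) (x : 𝔥) : ⁅g.H x, z⁆ = ν x • z := by
  induction h with
  | base => exact hy x
  | step k h ih =>
    rw [leibniz_lie, ih, g.lie_H_F, LinearMap.sub_apply, neg_lie, smul_lie, lie_smul]
    module

theorem LoweringWord.exists_degree {g : R.ChevalleyGenerators L} {y : L} {μ : Module.Dual ℂ 𝔥}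
    {δ : 𝔥} (hδ : ∀ i, R.simpleRoot i δ = 1) (hμ : ∃ n : ℤ, n < 0 ∧ μ δ = n)
    {ν : Module.Dual ℂ 𝔥} {z : L} (h : g.LoweringWord y μ ν z) : ∃ n : ℤ, n < 0 ∧ ν δ = n := by
  induction h with
  | base => exact hμ
  | step k h ih =>
    obtain ⟨m, hm, hm'⟩ := ih
    exact ⟨m - 1, by omega, by rw [LinearMap.sub_apply, hm', hδ]; push_cast; rfl⟩

/-- As every `eₖ` kills `y`, moving `eₖ` through a lowering word only leaves elements of `𝔥`, which
act by scalars; hence the span of these words is an ideal. Its degrees under `δ` are negative, while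
`𝔥` has degree zero. -/
theorem exists_ideal_of_singular {y : L} {μ : Module.Dual ℂ 𝔥}
    (hy : ∀ x, ⁅g.H x, y⁆ = μ x • y) (hE : ∀ k, ⁅g.E k, y⁆ = 0) {δ : 𝔥}
    (hδ : ∀ i, R.simpleRoot i δ = 1) {n : ℤ} (hn : n < 0) (hμ : μ δ = n) :
    ∃ J : LieIdeal ℂ L, y ∈ J ∧ J.toSubmodule ⊓ LinearMap.range g.H = ⊥ := by
  let U : Submodule ℂ L := Submodule.span ℂ {z | ∃ ν, g.LoweringWord y μ ν z}
  have stable : ∀ a : L, (∀ ν z, g.LoweringWord y μ ν z → ⁅a, z⁆ ∈ U) → ∀ u ∈ U, ⁅a, u⁆ ∈ U := by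
    intro a ha u hu
    induction hu using Submodule.span_induction with
    | mem z hz => obtain ⟨ν, hz⟩ := hz; exact ha ν z hz
    | zero => rw [lie_zero]; exact zero_mem _
    | add p q _ _ hp hq => rw [lie_add]; exact add_mem hp hq
    | smul c p _ hp => rw [lie_smul]; exact U.smul_mem c hp
  have hUH : ∀ x, ∀ u ∈ U, ⁅g.H x, u⁆ ∈ U := fun x => stable _ fun ν z hz => by
    rw [hz.lie_H hy]
    exact U.smul_mem _ (Submodule.subset_span ⟨ν, hz⟩)
  have hUF : ∀ k, ∀ u ∈ U, ⁅g.F k, u⁆ ∈ U := fun k => stable _ fun ν z hz =>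
    Submodule.subset_span ⟨_, hz.step k⟩
  have hUE : ∀ k, ∀ u ∈ U, ⁅g.E k, u⁆ ∈ U := fun k => stable _ fun ν z hz => by
    induction hz with
    | base => rw [hE]; exact zero_mem _
    | step j h ih =>
      rw [leibniz_lie]
      refine add_mem ?_ (hUF j _ ih)
      by_cases hkj : k = j
      · subst hkj
        rw [g.lie_E_F_same]
        exact hUH _ _ (Submodule.subset_span ⟨_, h⟩)
      · rw [g.lie_E_F_ne k j hkj, zero_lie]; exact zero_mem _
  refine ⟨{ U with lie_mem := fun {x m} hm => g.lie_mem_of_stable hUE hUF hUH x hm },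
    Submodule.subset_span ⟨μ, .base⟩, ?_⟩
  rw [Submodule.eq_bot_iff]
  rintro _ ⟨hx, ⟨x, rfl⟩⟩
  have hU : U ≤ g.degreeSum δ (Set.Iio 0) := Submodule.span_le.2 <| by
    rintro z ⟨ν, hz⟩
    obtain ⟨m, hm, hm'⟩ := hz.exists_degree hδ ⟨n, hn, hμ⟩
    exact g.mem_degreeSum (n := m) (Set.mem_Iio.2 hm) (by rw [hz.lie_H hy, hm'])
  exact g.eq_zero_of_mem_degreeSum (n := 0) (by simp) (hU hx) (by simp [g.lie_H_H])

theorem lie_H_ad_F_pow (i j : I) (x : 𝔥) (n : ℕ) :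
    ⁅g.H x, (ad ℂ L (g.F i) ^ n) (g.F j)⁆ =
      (-(n • R.simpleRoot i + R.simpleRoot j)) x • (ad ℂ L (g.F i) ^ n) (g.F j) := by
  induction n with
  | zero => simp [g.lie_H_F]
  | succ n ih =>
    rw [pow_succ', Module.End.mul_apply, ad_apply, leibniz_lie, ih, g.lie_H_F]
    simp only [neg_lie, smul_lie, lie_smul, LinearMap.neg_apply, LinearMap.add_apply,
      LinearMap.smul_apply, ← Nat.cast_smul_eq_nsmul ℂ, smul_eq_mul]
    push_cast
    module

/-- With `N = -aᵢⱼ`, the vector `fⱼ` has weight `N` for `αᵢ^∨`, and the exponent `N + 1` makes the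
`𝔰𝔩₂` coefficient `N - N (N + 1 - N)` vanish when `k = i`. When `k = j` the bracket is `aⱼᵢ fᵢ^N
fᵢ`, zero because either `aⱼᵢ = 0` or `N ≥ 1`. The other `eₖ` commute with `fᵢ` and `fⱼ`. -/
theorem lie_E_serre (hA : IsGCM A) {i j : I} (hij : i ≠ j) (k : I) :
    ⁅g.E k, (ad ℂ L (g.F i) ^ ((-A i j).toNat + 1)) (g.F j)⁆ = 0 := by
  have hle := hA.nonpos i j hij
  by_cases hki : k = i
  · subst hki
    have hm : (((-A k j).toNat : ℕ) : ℂ) = -(A k j : ℂ) := by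
      exact_mod_cast Int.toNat_of_nonneg (by omega : (0 : ℤ) ≤ -A k j)
    have h1 : ⁅g.H (R.simpleCoroot k), g.F j⁆ = (((-A k j).toNat : ℕ) : ℂ) • g.F j := by
      rw [g.lie_H_F, R.simpleRoot_simpleCoroot, hm, neg_smul]
    have h2 : ⁅g.E k, ⁅g.F k, g.F j⁆⁆ = (((-A k j).toNat : ℕ) : ℂ) • g.F j := by
      rw [leibniz_lie, g.lie_E_F_same, g.lie_E_F_ne k j hij, lie_zero, add_zero, h1]
    rw [(g.isSl2Relations hA k).lie_e_ad_f_pow_succ h1, h2, ← sub_smul]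
    ring_nf
    simp
  · have hcomm : ∀ n z, ⁅g.E k, (ad ℂ L (g.F i) ^ n) z⁆ = (ad ℂ L (g.F i) ^ n) ⁅g.E k, z⁆ := by
      intro n z
      induction n with
      | zero => simp
      | succ n ih =>
        rw [pow_succ', Module.End.mul_apply, Module.End.mul_apply, ad_apply, ad_apply, leibniz_lie,
          g.lie_E_F_ne k i hki, zero_lie, zero_add, ih]
    rw [hcomm]
    by_cases hkj : k = j
    · subst hkj
      rw [g.lie_E_F_same, pow_succ, Module.End.mul_apply, ad_apply, ← lie_skew, g.lie_H_F,
        R.simpleRoot_simpleCoroot, neg_neg]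
      by_cases h0 : A i k = 0
      · simp [hA.zero_symm i k h0]
      · obtain ⟨n, hn⟩ : ∃ n, (-A i k).toNat = n + 1 := ⟨(-A i k).toNat - 1, by omega⟩
        rw [hn, pow_succ, Module.End.mul_apply, ad_apply, lie_smul, lie_self, smul_zero, map_zero]
    · rw [g.lie_E_F_ne k j hkj, map_zero]

theorem exists_ideal_serre (hA : IsGCM A) {i j : I} (hij : i ≠ j) :
    ∃ J : LieIdeal ℂ L, (ad ℂ L (g.F i) ^ ((-A i j).toNat + 1)) (g.F j) ∈ J ∧
      J.toSubmodule ⊓ LinearMap.range g.H = ⊥ := by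
  obtain ⟨δ, hδ⟩ := R.exists_simpleRoot_eq fun _ => 1
  refine g.exists_ideal_of_singular (g.lie_H_ad_F_pow i j · _) (g.lie_E_serre hA hij) hδ
    (n := -(((-A i j).toNat + 1 + 1 : ℕ) : ℤ)) (by omega) ?_
  rw [Int.cast_neg, Int.cast_natCast]
  simp [hδ, ← Nat.cast_smul_eq_nsmul ℂ]

/-! ### Triangular decomposition -/

/-- The subalgebra generated by the `eᵢ`. -/
def positive : LieSubalgebra ℂ L := LieSubalgebra.lieSpan ℂ L (Set.range g.E)

theorem lie_H_mem_positive (h : 𝔥) {x : L} (hx : x ∈ g.positive) : ⁅g.H h, x⁆ ∈ g.positive := by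
  induction hx using LieSubalgebra.lieSpan_induction with
  | mem x hx =>
    obtain ⟨i, rfl⟩ := hx
    rw [g.lie_H_E]
    exact g.positive.smul_mem _ (LieSubalgebra.subset_lieSpan ⟨i, rfl⟩)
  | zero => rw [lie_zero]; exact zero_mem _
  | add x y _ _ hx hy => rw [lie_add]; exact add_mem hx hy
  | smul c x _ hx => rw [lie_smul]; exact g.positive.smul_mem c hx
  | lie x y hx' hy' hx hy =>
    rw [leibniz_lie]
    exact add_mem (g.positive.lie_mem hx hy') (g.positive.lie_mem hx' hy)

/-- The derivation `ad fⱼ` sends each `eᵢ` into `𝔥`, and `𝔥` plus the positive part normalizes the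
positive part, so the property passes to brackets. -/
theorem lie_F_mem (j : I) {x : L} (hx : x ∈ g.positive) :
    ⁅g.F j, x⁆ ∈ LinearMap.range g.H ⊔ g.positive.toSubmodule := by
  have key : ∀ a ∈ LinearMap.range g.H ⊔ g.positive.toSubmodule, ∀ y ∈ g.positive,
      ⁅a, y⁆ ∈ g.positive := by
    intro a ha y hy
    obtain ⟨_, ⟨h, rfl⟩, b, hb, rfl⟩ := Submodule.mem_sup.1 ha
    rw [add_lie]
    exact add_mem (g.lie_H_mem_positive h hy) (g.positive.lie_mem hb hy)
  induction hx using LieSubalgebra.lieSpan_induction with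
  | mem x hx =>
    obtain ⟨i, rfl⟩ := hx
    refine Submodule.mem_sup_left ?_
    rw [← lie_skew]
    by_cases hij : i = j
    · subst hij
      rw [g.lie_E_F_same]
      exact neg_mem (LinearMap.mem_range_self _ _)
    · rw [g.lie_E_F_ne i j hij, neg_zero]
      exact zero_mem _
  | zero => rw [lie_zero]; exact zero_mem _
  | add x y _ _ hx hy => rw [lie_add]; exact add_mem hx hy
  | smul c x _ hx => rw [lie_smul]; exact Submodule.smul_mem _ c hx
  | lie x y hx' hy' hx hy =>
    rw [leibniz_lie]
    refine Submodule.mem_sup_right (add_mem (key _ hx y hy') ?_)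
    rw [← lie_skew]
    exact neg_mem (key _ hy x hx')

/-- The sum of the two triangular parts and `𝔥`. -/
def triangular : Submodule ℂ L :=
  LinearMap.range g.H ⊔ g.positive.toSubmodule ⊔ g.opposite.positive.toSubmodule

theorem triangular_opposite : g.opposite.triangular = g.triangular := by
  have h : LinearMap.range g.opposite.H = LinearMap.range g.H := LinearMap.range_neg g.H
  rw [triangular, triangular, h, sup_assoc, sup_assoc,
    sup_comm g.opposite.positive.toSubmodule]
  rfl

theorem lie_F_mem_triangular (j : I) {x : L} (hx : x ∈ g.triangular) :
    ⁅g.F j, x⁆ ∈ g.triangular := by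
  have hF : g.F j ∈ g.opposite.positive := LieSubalgebra.subset_lieSpan ⟨j, rfl⟩
  obtain ⟨a, ha, c, hc, rfl⟩ := Submodule.mem_sup.1 hx
  obtain ⟨_, ⟨h, rfl⟩, b, hb, rfl⟩ := Submodule.mem_sup.1 ha
  rw [lie_add, lie_add]
  refine add_mem (add_mem ?_ (Submodule.mem_sup_left (g.lie_F_mem j hb)))
    (Submodule.mem_sup_right (g.opposite.positive.lie_mem hF hc))
  rw [← lie_skew, g.lie_H_F, neg_neg]
  exact Submodule.mem_sup_right (g.opposite.positive.smul_mem _ hF)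

/-- The sum contains the generators and is stable under bracketing with them; the case of `eᵢ`
follows from that of `fᵢ` through `opposite`. -/
theorem triangular_eq_top : g.triangular = ⊤ := by
  have hE : ∀ i, ∀ u ∈ g.triangular, ⁅g.E i, u⁆ ∈ g.triangular := fun i u hu => by
    rw [← triangular_opposite] at hu ⊢
    exact g.opposite.lie_F_mem_triangular i hu
  have hH : ∀ h, ∀ u ∈ g.triangular, ⁅g.H h, u⁆ ∈ g.triangular := fun h u hu => by
    obtain ⟨a, ha, c, hc, rfl⟩ := Submodule.mem_sup.1 hu
    obtain ⟨_, ⟨h', rfl⟩, b, hb, rfl⟩ := Submodule.mem_sup.1 ha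
    rw [lie_add, lie_add, g.lie_H_H, zero_add]
    refine add_mem (Submodule.mem_sup_left (Submodule.mem_sup_right (g.lie_H_mem_positive h hb)))
      (Submodule.mem_sup_right ?_)
    have := g.opposite.lie_H_mem_positive (-h) hc
    rwa [show g.opposite.H (-h) = g.H h by simp [opposite]] at this
  let K : LieSubalgebra ℂ L :=
    { g.triangular with
      lie_mem' := fun {a b} _ hb =>
        g.lie_mem_of_stable hE (fun i _ hu => g.lie_F_mem_triangular i hu) hH a hb }
  have hK : K = ⊤ := g.generates K
    (fun i => Submodule.mem_sup_left (Submodule.mem_sup_right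
      (LieSubalgebra.subset_lieSpan ⟨i, rfl⟩)))
    (fun i => Submodule.mem_sup_right (LieSubalgebra.subset_lieSpan ⟨i, rfl⟩))
    (fun x => Submodule.mem_sup_left (Submodule.mem_sup_left (LinearMap.mem_range_self _ x)))
  exact eq_top_iff.2 fun x _ => (hK ▸ LieSubalgebra.mem_top x : x ∈ K)

/-- The weight space of a simple root is spanned by `eᵢ`. -/
theorem mem_span_E (i : I) {x : L} (hx : ∀ h, ⁅g.H h, x⁆ = R.simpleRoot i h • x) :
    x ∈ Submodule.span ℂ {g.E i} := by
  classical
  -- For this grading `eᵢ` is the only generator of degree `1`; brackets of positive elements have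
  -- degree at least `2`, and everything else has degree at most `0`.
  obtain ⟨δ, hδ⟩ := R.exists_simpleRoot_eq fun j => if j = i then 1 else 2
  have hi : R.simpleRoot i δ = 1 := by simp [hδ]
  have hEi : ⁅g.H δ, g.E i⁆ = ((1 : ℤ) : ℂ) • g.E i := by simp [g.lie_H_E, hi]
  have hpos : g.positive.toSubmodule ≤ Submodule.span ℂ {g.E i} ⊔ g.degreeSum δ (Set.Ici 2) := by
    have hle : Submodule.span ℂ {g.E i} ⊔ g.degreeSum δ (Set.Ici 2) ≤
        g.degreeSum δ (Set.Ici 1) := by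
      refine sup_le ?_ (g.degreeSum_mono (Set.Ici_subset_Ici.2 (by norm_num)))
      rw [Submodule.span_singleton_le_iff_mem]
      exact g.mem_degreeSum (n := 1) (by simp) hEi
    intro x hx
    induction hx using LieSubalgebra.lieSpan_induction with
    | mem x hx =>
      obtain ⟨j, rfl⟩ := hx
      by_cases hj : j = i
      · subst hj
        exact Submodule.mem_sup_left (Submodule.mem_span_singleton_self _)
      · exact Submodule.mem_sup_right (g.mem_degreeSum (n := 2) (by simp)
          (by simp [g.lie_H_E, hδ, hj]))
    | zero => exact zero_mem _
    | add x y _ _ hx hy => exact add_mem hx hy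
    | smul c x _ hx => exact Submodule.smul_mem _ c hx
    | lie x y _ _ hx hy =>
      refine Submodule.mem_sup_right (g.lie_mem_degreeSum ?_ (hle hx) (hle hy))
      intro m hm n hn
      simp only [Set.mem_Ici] at hm hn ⊢
      omega
  have hneg : g.opposite.positive.toSubmodule ≤ g.degreeSum δ (Set.Iio 0) := by
    intro x hx
    induction hx using LieSubalgebra.lieSpan_induction with
    | mem x hx =>
      obtain ⟨j, rfl⟩ := hx
      by_cases hj : j = i
      · exact g.mem_degreeSum (n := -1) (by simp) (by simp [opposite, g.lie_H_F, hδ, hj])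
      · exact g.mem_degreeSum (n := -2) (by simp) (by simp [opposite, g.lie_H_F, hδ, hj])
    | zero => exact zero_mem _
    | add x y _ _ hx hy => exact add_mem hx hy
    | smul c x _ hx => exact Submodule.smul_mem _ c hx
    | lie x y _ _ hx hy =>
      refine g.lie_mem_degreeSum ?_ hx hy
      intro m hm n hn
      simp only [Set.mem_Iio] at hm hn ⊢
      omega
  have hall : (⊤ : Submodule ℂ L) ≤ Submodule.span ℂ {g.E i} ⊔ g.degreeSum δ {1}ᶜ := by
    rw [← g.triangular_eq_top, triangular]
    refine sup_le (sup_le ?_ (hpos.trans (sup_le_sup_left (g.degreeSum_mono ?_) _)))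
      ((hneg.trans (g.degreeSum_mono ?_)).trans le_sup_right)
    · rintro _ ⟨h, rfl⟩
      exact Submodule.mem_sup_right (g.mem_degreeSum (n := 0) (by simp) (by simp [g.lie_H_H]))
    · intro n hn
      simp only [Set.mem_Ici, Set.mem_compl_iff, Set.mem_singleton_iff] at hn ⊢
      omega
    · intro n hn
      simp only [Set.mem_Iio, Set.mem_compl_iff, Set.mem_singleton_iff] at hn ⊢
      omega
  obtain ⟨a, ha, b, hb, rfl⟩ := Submodule.mem_sup.1 (hall (Submodule.mem_top (x := x)))
  obtain ⟨c, rfl⟩ := Submodule.mem_span_singleton.1 ha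
  have hb0 : b = 0 := by
    refine g.eq_zero_of_mem_degreeSum (n := 1) (by simp) hb ?_
    have h1 := hx δ
    rw [lie_add, lie_smul, hEi, hi, smul_add] at h1
    simpa using h1
  rwa [hb0, add_zero]

end ChevalleyGenerators

end Realization

/-! ### Local nilpotency, lifts of the Weyl group and integrability. -/

namespace Realization

open LieAlgebra

variable {I : Type*} [Fintype I] {A : Matrix I I ℤ} {𝔥 : Type*} [AddCommGroup 𝔥] [Module ℂ 𝔥]

namespace ChevalleyGenerators

variable {R : Realization A 𝔥} {L : Type*} [LieRing L] [LieAlgebra ℂ L]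
  (g : R.ChevalleyGenerators L)

/-- The Serre relations make `eᵢ` locally ad-nilpotent. -/
theorem engel_E_eq_top
    (hserre : ∀ i j, i ≠ j → (ad ℂ L (g.E i) ^ ((-A i j).toNat + 1)) (g.E j) = 0) (i : I) :
    LieSubalgebra.engel ℂ (g.E i) = ⊤ := by
  have hEEH : ∀ x, ⁅g.E i, ⁅g.E i, g.H x⁆⁆ = 0 := fun x => by
    rw [← lie_skew (g.E i) (g.H x), g.lie_H_E]; simp
  -- The Engel space is a subalgebra, so nilpotency need only be tested on generators. The exponents
  -- `3` and `2` below reflect the chain `fᵢ`, `αᵢ^∨`, `eᵢ`, `0`.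
  refine g.generates _ (fun j => ?_) (fun j => ?_) (fun x => ?_)
  · by_cases hij : i = j
    · subst hij
      exact LieSubalgebra.self_mem_engel ℂ _
    · exact (LieSubalgebra.mem_engel_iff ℂ _ _).2 ⟨_, hserre i j hij⟩
  · refine (LieSubalgebra.mem_engel_iff ℂ _ _).2 ⟨3, ?_⟩
    simp only [pow_succ, pow_zero, one_mul, Module.End.mul_apply, ad_apply]
    by_cases hij : i = j
    · subst hij
      rw [g.lie_E_F_same, hEEH]
    · rw [g.lie_E_F_ne i j hij, lie_zero, lie_zero]
  · refine (LieSubalgebra.mem_engel_iff ℂ _ _).2 ⟨2, ?_⟩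
    simp only [pow_succ, pow_zero, one_mul, Module.End.mul_apply, ad_apply, hEEH]

/-- The lift `exp (ad eᵢ) exp (-ad fᵢ) exp (ad eᵢ)` of a simple reflection. -/
theorem exists_hom_simpleReflection (hA : IsGCM A) {i : I}
    (hE : LieSubalgebra.engel ℂ (g.E i) = ⊤) (hF : LieSubalgebra.engel ℂ (g.F i) = ⊤) :
    ∃ φ : L →ₗ⁅ℂ⁆ L, Function.Injective φ ∧
      ∀ x, φ (g.H x) = g.H (x - R.simpleRoot i x • R.simpleCoroot i) := by
  have hF' : LieSubalgebra.engel ℂ (-g.F i) = ⊤ := by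
    simpa using engel_smul_eq_top hF (-1)
  have t := g.isSl2Relations hA i
  have hEH : ∀ x, ⁅g.E i, g.H x⁆ = -(R.simpleRoot i x • g.E i) := fun x => by
    rw [← lie_skew, g.lie_H_E]
  have hFH : ∀ x, ⁅-g.F i, g.H x⁆ = -(R.simpleRoot i x • g.F i) := fun x => by
    rw [neg_lie, lie_skew, g.lie_H_F]
  have hFE : ⁅-g.F i, g.E i⁆ = g.H (R.simpleCoroot i) := by
    rw [neg_lie, lie_skew, g.lie_E_F_same]
  have h2 : R.simpleRoot i (R.simpleCoroot i) = 2 := by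
    rw [R.simpleRoot_simpleCoroot, hA.diag]; norm_num
  have e1 : ∀ x, expAd (g.E i) hE (g.H x) = g.H x - R.simpleRoot i x • g.E i := fun x => by
    rw [expAd_of_lie_lie_eq_zero hE (by rw [hEH]; simp), hEH, sub_eq_add_neg]
  have e2 : expAd (g.E i) hE (g.E i) = g.E i := expAd_of_lie_eq_zero hE (lie_self _)
  have f1 : ∀ x, expAd (-g.F i) hF' (g.H x) = g.H x - R.simpleRoot i x • g.F i := fun x => by
    rw [expAd_of_lie_lie_eq_zero hF' (by rw [hFH]; simp), hFH, sub_eq_add_neg]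
  have f2 : expAd (-g.F i) hF' (g.E i) = g.E i + g.H (R.simpleCoroot i) - g.F i := by
    rw [expAd_of_lie_lie_lie_eq_zero hF' (by rw [hFE, hFH]; simp), hFE, hFH, h2]
    module
  refine ⟨((expAd (g.E i) hE).comp (expAd (-g.F i) hF')).comp (expAd (g.E i) hE),
    (expAd_injective hE).comp ((expAd_injective hF').comp (expAd_injective hE)), fun x => ?_⟩
  have h3 : R.simpleRoot i (x - R.simpleRoot i x • R.simpleCoroot i) = -R.simpleRoot i x := by
    rw [map_sub, map_smul, h2, smul_eq_mul]; ring
  -- The remaining term `-αᵢ(x) eᵢ` is cancelled by the last exponential, because `αᵢ` changes sign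
  -- under the reflection.
  have h4 : expAd (-g.F i) hF' (expAd (g.E i) hE (g.H x)) =
      g.H (x - R.simpleRoot i x • R.simpleCoroot i) - R.simpleRoot i x • g.E i := by
    rw [e1, map_sub, map_smul, f1, f2, map_sub, map_smul]
    module
  rw [LieHom.comp_apply, LieHom.comp_apply, h4, map_sub, map_smul, e1, e2, h3]
  module

end ChevalleyGenerators

/-! ### The Weyl group -/

/-- The simple reflections of `𝔥`. -/
noncomputable def simpleReflection (R : Realization A 𝔥) (hA : IsGCM A) (i : I) : 𝔥 ≃ₗ[ℂ] 𝔥 :=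
  LinearEquiv.ofInvolutive (LinearMap.id - (R.simpleRoot i).smulRight (R.simpleCoroot i)) <| by
    intro h
    simp only [LinearMap.sub_apply, LinearMap.id_apply, LinearMap.smulRight_apply, map_sub,
      map_smul, R.simpleRoot_simpleCoroot, hA.diag]
    push_cast
    module

theorem simpleReflection_apply (R : Realization A 𝔥) (hA : IsGCM A) (i : I) (h : 𝔥) :
    R.simpleReflection hA i h = h - R.simpleRoot i h • R.simpleCoroot i := rfl

theorem simpleReflection_mem (R : Realization A 𝔥) (hA : IsGCM A) (i : I) :
    R.simpleReflection hA i ∈ R.weylGroup :=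
  Subgroup.subset_closure ⟨i, R.simpleReflection_apply hA i⟩

/-- Simple reflections are involutions, so inverses need no separate case; lifts of Weyl elements
can therefore be merely injective. -/
theorem weylGroup_induction (R : Realization A 𝔥) (hA : IsGCM A) {p : (𝔥 ≃ₗ[ℂ] 𝔥) → Prop}
    (one : p 1) (mul : ∀ v w, p v → p w → p (v * w)) (simple : ∀ i, p (R.simpleReflection hA i))
    {w : 𝔥 ≃ₗ[ℂ] 𝔥} (hw : w ∈ R.weylGroup) : p w := by
  have eq : ∀ (s : 𝔥 ≃ₗ[ℂ] 𝔥) (i : I), (∀ h, s h = h - R.simpleRoot i h • R.simpleCoroot i) →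
      s = R.simpleReflection hA i := fun s i hs => LinearEquiv.ext hs
  induction hw using Subgroup.closure_induction'' with
  | one => exact one
  | mem s hs =>
    obtain ⟨i, hi⟩ := hs
    rw [eq s i hi]
    exact simple i
  | inv_mem s hs =>
    obtain ⟨i, hi⟩ := hs
    rw [eq s i hi]
    exact simple i
  | mul v w _ _ hv hw => exact mul v w hv hw

theorem ChevalleyGenerators.exists_hom_weylGroup {R : Realization A 𝔥} {L : Type*} [LieRing L]
    [LieAlgebra ℂ L] (g : R.ChevalleyGenerators L) (hA : IsGCM A)
    (hE : ∀ i, LieSubalgebra.engel ℂ (g.E i) = ⊤) (hF : ∀ i, LieSubalgebra.engel ℂ (g.F i) = ⊤)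
    {w : 𝔥 ≃ₗ[ℂ] 𝔥} (hw : w ∈ R.weylGroup) :
    ∃ φ : L →ₗ⁅ℂ⁆ L, Function.Injective φ ∧ ∀ x, φ (g.H x) = g.H (w x) := by
  refine R.weylGroup_induction hA
    (p := fun w => ∃ φ : L →ₗ⁅ℂ⁆ L, Function.Injective φ ∧ ∀ x, φ (g.H x) = g.H (w x))
    ⟨LieHom.id, fun _ _ h => h, fun _ => rfl⟩ ?_
    (fun i => g.exists_hom_simpleReflection hA (hE i) (hF i)) hw
  rintro v w ⟨φ, hφ, hφ'⟩ ⟨ψ, hψ, hψ'⟩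
  exact ⟨φ.comp ψ, hφ.comp hψ, fun x => by rw [LieHom.comp_apply, hψ', hφ']; rfl⟩

/-- The lattice spanned by the simple coroots. -/
def corootLattice (R : Realization A 𝔥) : AddSubgroup 𝔥 :=
  AddSubgroup.closure (Set.range R.simpleCoroot)

theorem exists_int_of_mem_corootLattice (R : Realization A 𝔥) (i : I) {x : 𝔥}
    (hx : x ∈ R.corootLattice) : ∃ m : ℤ, R.simpleRoot i x = m := by
  induction hx using AddSubgroup.closure_induction with
  | mem x hx =>
    obtain ⟨j, rfl⟩ := hx
    exact ⟨_, R.simpleRoot_simpleCoroot j i⟩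
  | zero => exact ⟨0, by simp⟩
  | add x y _ _ hx hy =>
    obtain ⟨m, hm⟩ := hx
    obtain ⟨n, hn⟩ := hy
    exact ⟨m + n, by simp [hm, hn]⟩
  | neg x _ hx =>
    obtain ⟨m, hm⟩ := hx
    exact ⟨-m, by simp [hm]⟩

theorem weylGroup_apply_mem_corootLattice (R : Realization A 𝔥) (hA : IsGCM A) {w : 𝔥 ≃ₗ[ℂ] 𝔥}
    (hw : w ∈ R.weylGroup) {x : 𝔥} (hx : x ∈ R.corootLattice) : w x ∈ R.corootLattice := by
  refine R.weylGroup_induction hA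
    (p := fun w => ∀ x ∈ R.corootLattice, w x ∈ R.corootLattice) (fun _ h => h)
    (fun v w hv hw x hx => hv _ (hw x hx)) (fun i x hx => ?_) hw x hx
  obtain ⟨m, hm⟩ := R.exists_int_of_mem_corootLattice i hx
  rw [R.simpleReflection_apply, hm, Int.cast_smul_eq_zsmul]
  have hi : R.simpleCoroot i ∈ R.corootLattice := AddSubgroup.subset_closure ⟨i, rfl⟩
  exact sub_mem hx (zsmul_mem hi m)

/-- The Weyl group preserves the coroot lattice, on which simple roots are integral. Integrality of
`β(α^∨)` places `s_α(β)` on the `α`-string through `β`. -/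
theorem Presents.exists_int {R : Realization A 𝔥} (hA : IsGCM A) {α β : Module.Dual ℂ 𝔥}
    {p q : (𝔥 ≃ₗ[ℂ] 𝔥) × I} (hp : R.Presents α p) (hq : R.Presents β q) :
    ∃ m : ℤ, β (p.1 (R.simpleCoroot p.2)) = m := by
  rw [hq.2]
  exact R.exists_int_of_mem_corootLattice _ (R.weylGroup_apply_mem_corootLattice hA
    (inv_mem hq.1) (R.weylGroup_apply_mem_corootLattice hA hp.1
      (AddSubgroup.subset_closure ⟨_, rfl⟩)))

/-- The reflection in a real root of a conjugate of a simple root is again a conjugate of a simple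
root. -/
theorem Presents.sub_smul {R : Realization A 𝔥} (hA : IsGCM A) {α β : Module.Dual ℂ 𝔥}
    {p q : (𝔥 ≃ₗ[ℂ] 𝔥) × I} (hp : R.Presents α p) (hq : R.Presents β q) :
    R.Presents (β - β (p.1 (R.simpleCoroot p.2)) • α)
      (p.1 * R.simpleReflection hA p.2 * p.1⁻¹ * q.1, q.2) := by
  refine ⟨mul_mem (mul_mem (mul_mem hp.1 (R.simpleReflection_mem hA _)) (inv_mem hp.1)) hq.1, ?_⟩
  have hinv : (R.simpleReflection hA p.2)⁻¹ = R.simpleReflection hA p.2 := rfl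
  have h1 : ∀ x, p.1 (p.1⁻¹ x) = x := p.1.apply_symm_apply
  ext x
  simp only [mul_inv_rev, hinv, inv_inv, LinearMap.comp_apply, LinearEquiv.coe_coe,
    LinearEquiv.mul_apply, R.simpleReflection_apply, map_sub, map_smul, h1, LinearMap.sub_apply,
    LinearMap.smul_apply]
  rw [hp.2, hq.2]
  simp only [LinearMap.comp_apply, LinearEquiv.coe_coe, smul_eq_mul]
  ring

theorem Presents.apply_self {R : Realization A 𝔥} (hA : IsGCM A) {α : Module.Dual ℂ 𝔥}
    {p : (𝔥 ≃ₗ[ℂ] 𝔥) × I} (hp : R.Presents α p) : α (p.1 (R.simpleCoroot p.2)) = 2 := by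
  have h : (p.1⁻¹ : 𝔥 ≃ₗ[ℂ] 𝔥) (p.1 (R.simpleCoroot p.2)) = R.simpleCoroot p.2 :=
    p.1.symm_apply_apply _
  rw [hp.2, LinearMap.comp_apply, LinearEquiv.coe_coe, h, R.simpleRoot_simpleCoroot, hA.diag]
  norm_num

theorem Presents.neg {R : Realization A 𝔥} (hA : IsGCM A) {α : Module.Dual ℂ 𝔥}
    {p : (𝔥 ≃ₗ[ℂ] 𝔥) × I} (hp : R.Presents α p) : ∃ q, R.Presents (-α) q := by
  have h := hp.sub_smul hA hp
  rw [hp.apply_self hA] at h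
  exact ⟨_, by convert h using 1; module⟩

/-! ### The Kac-Moody algebra is integrable -/

section KacMoody

variable (R : Realization A 𝔥)

/-- The generators of `𝔤̃(A)`. -/
noncomputable def tildeGenerators : R.ChevalleyGenerators R.Tilde where
  H := R.tildeCartan
  E i := LieSubmodule.Quotient.mk (R.freeE i)
  F i := LieSubmodule.Quotient.mk (R.freeF i)
  lie_H_H x y := by
    refine (LieSubmodule.Quotient.mk_bracket _ _ _).symm.trans ?_
    exact LieSubmodule.Quotient.mk_eq_zero'.2 (LieSubmodule.subset_lieSpan (Relator.hh x y))
  lie_E_F_same i := by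
    refine (LieSubmodule.Quotient.mk_bracket _ _ _).symm.trans ?_
    exact (Submodule.Quotient.eq R.relationIdeal.toSubmodule).2
      (LieSubmodule.subset_lieSpan (Relator.ef_same i))
  lie_E_F_ne i j hij := by
    refine (LieSubmodule.Quotient.mk_bracket _ _ _).symm.trans ?_
    exact LieSubmodule.Quotient.mk_eq_zero'.2 (LieSubmodule.subset_lieSpan (Relator.ef_ne i j hij))
  lie_H_E x i := by
    refine (LieSubmodule.Quotient.mk_bracket _ _ _).symm.trans ?_
    exact (Submodule.Quotient.eq R.relationIdeal.toSubmodule).2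
      (LieSubmodule.subset_lieSpan (Relator.he x i))
  lie_H_F x i := by
    refine (LieSubmodule.Quotient.mk_bracket _ _ _).symm.trans ?_
    refine (Submodule.Quotient.eq R.relationIdeal.toSubmodule
      (y := -(R.simpleRoot i x • R.freeF i))).2 ?_
    rw [sub_neg_eq_add]
    exact LieSubmodule.subset_lieSpan (Relator.hf x i)
  generates K hE hF hH := by
    let π : R.Free →ₗ⁅ℂ⁆ R.Tilde :=
      { (LieSubmodule.Quotient.mk' R.relationIdeal : R.Free →ₗ[ℂ] R.Tilde) with
        map_lie' := fun {x y} => LieSubmodule.Quotient.mk_bracket _ x y }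
    have hK : ∀ a, π (FreeLieAlgebra.of ℂ a) ∈ K
      | .e i => hE i
      | .f i => hF i
      | .h x => hH x
    let ψ : R.Free →ₗ⁅ℂ⁆ K := FreeLieAlgebra.lift ℂ fun a => ⟨π (FreeLieAlgebra.of ℂ a), hK a⟩
    have hψ : K.incl.comp ψ = π := by
      ext a
      simp [ψ]
    refine eq_top_iff.2 fun y _ => ?_
    obtain ⟨x, rfl⟩ := LieSubmodule.Quotient.surjective_mk' R.relationIdeal y
    have h : π x = ψ x := by rw [← hψ]; rfl
    exact (h ▸ (ψ x).2 : π x ∈ K)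

/-- The quotient map from `𝔤̃(A)` to `𝔤(A)`. -/
noncomputable def toKacMoody : R.Tilde →ₗ⁅ℂ⁆ R.KacMoodyAlgebra :=
  { (LieSubmodule.Quotient.mk' R.radical : R.Tilde →ₗ[ℂ] R.KacMoodyAlgebra) with
    map_lie' := fun {x y} => LieSubmodule.Quotient.mk_bracket _ x y }

theorem toKacMoody_eq_zero {x : R.Tilde} (hx : x ∈ R.radical) : R.toKacMoody x = 0 :=
  LieSubmodule.Quotient.mk_eq_zero'.2 hx

/-- The generators of `𝔤(A)`. -/
noncomputable def generators : R.ChevalleyGenerators R.KacMoodyAlgebra :=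
  R.tildeGenerators.map R.toKacMoody (LieSubmodule.Quotient.surjective_mk' R.radical)

theorem generators_H : R.generators.H = R.cartan := rfl

theorem toKacMoody_ad_pow (x y : R.Tilde) (n : ℕ) :
    R.toKacMoody ((ad ℂ R.Tilde x ^ n) y) =
      (ad ℂ R.KacMoodyAlgebra (R.toKacMoody x) ^ n) (R.toKacMoody y) := by
  induction n with
  | zero => rfl
  | succ n ih =>
    rw [pow_succ', pow_succ', Module.End.mul_apply, Module.End.mul_apply, ad_apply, ad_apply,
      LieHom.map_lie, ih]

/-- The Serre elements of `𝔤̃(A)` lie in ideals avoiding `𝔥`, hence in the radical, so the Serre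
relations hold in `𝔤(A)`. -/
theorem engel_generators_F (hA : IsGCM A) (i : I) :
    LieSubalgebra.engel ℂ (R.generators.F i) = ⊤ := by
  refine R.generators.opposite.engel_E_eq_top (fun i j hij => ?_) i
  obtain ⟨J, hJ, hJ'⟩ := R.tildeGenerators.exists_ideal_serre hA hij
  exact (R.toKacMoody_ad_pow _ _ _).symm.trans
    (R.toKacMoody_eq_zero ((le_sSup hJ' : J ≤ R.radical) hJ))

theorem engel_generators_E (hA : IsGCM A) (i : I) :
    LieSubalgebra.engel ℂ (R.generators.E i) = ⊤ := by
  refine R.generators.engel_E_eq_top (fun i j hij => ?_) i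
  obtain ⟨J, hJ, hJ'⟩ := R.tildeGenerators.opposite.exists_ideal_serre hA hij
  rw [show LinearMap.range R.tildeGenerators.opposite.H = LinearMap.range R.tildeCartan from
    LinearMap.range_neg _] at hJ'
  exact (R.toKacMoody_ad_pow _ _ _).symm.trans
    (R.toKacMoody_eq_zero ((le_sSup hJ' : J ≤ R.radical) hJ))

end KacMoody

end Realization

/-! ### Real root spaces and root strings inside a subalgebra. -/

/-- `e ^ k` does not kill the vector `x` of weight `m` if `m + k ≤ 0`, or if the weight `m + 2 k`
occurs on a vector that `f ^ k` maps to a multiple of `x`. -/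
theorem IsSl2Relations.ad_e_pow_ne_zero {L : Type*} [LieRing L] [LieAlgebra ℂ L] {h e f : L}
    (t : IsSl2Relations h e f) (he : LieSubalgebra.engel ℂ e = ⊤)
    (hf : LieSubalgebra.engel ℂ f = ⊤) {x : L} (hx : x ≠ 0) {m : ℤ} (hm : ⁅h, x⁆ = (m : ℂ) • x)
    {k : ℕ} (hk : m + k ≤ 0 ∨ ∃ y : L, y ≠ 0 ∧ ⁅h, y⁆ = ((m + 2 * k : ℤ) : ℂ) • y ∧
      ∃ c : ℂ, (LieAlgebra.ad ℂ L f ^ k) y = c • x) :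
    (LieAlgebra.ad ℂ L e ^ k) x ≠ 0 := by
  intro h0
  -- Either `k ≤ -m`, and `f^k e^k` is injective on the space of `x`, or `k ≤ m + 2k`, and `e^k f^k`
  -- is injective on the space of `y`.
  rcases le_or_gt (m + k) 0 with h1 | h1
  · obtain ⟨M, hM⟩ := Int.eq_ofNat_of_zero_le (by omega : 0 ≤ -m)
    refine hx (t.symm.eq_zero_of_ad_e_pow_ad_f_pow hf (M := M) (k := k) (by omega) ?_
      (by rw [h0, map_zero]))
    rw [neg_lie, hm, ← neg_smul, ← Int.cast_neg, hM, Int.cast_natCast]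
  · obtain ⟨y, hy0, hy, c, hc⟩ := hk.resolve_left (by omega)
    obtain ⟨M, hM⟩ := Int.eq_ofNat_of_zero_le (by omega : 0 ≤ m + 2 * k)
    refine hy0 (t.eq_zero_of_ad_e_pow_ad_f_pow he (M := M) (k := k) (by omega) ?_ ?_)
    · rw [hy, hM, Int.cast_natCast]
    · rw [hc, map_smul, h0, smul_zero]

namespace Realization

open LieAlgebra

variable {I : Type*} [Fintype I] {A : Matrix I I ℤ} {𝔥 : Type*} [AddCommGroup 𝔥] [Module ℂ 𝔥]
  {R : Realization A 𝔥}

theorem lie_mem_rootSpace {α β : Module.Dual ℂ 𝔥} {x y : R.KacMoodyAlgebra}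
    (hx : x ∈ R.rootSpace α) (hy : y ∈ R.rootSpace β) : ⁅x, y⁆ ∈ R.rootSpace (β + α) := by
  intro h
  rw [leibniz_lie, hx h, hy h, smul_lie, lie_smul, LinearMap.add_apply]
  module

theorem ad_pow_mem_rootSpace {α β : Module.Dual ℂ 𝔥} {x y : R.KacMoodyAlgebra}
    (hx : x ∈ R.rootSpace α) (hy : y ∈ R.rootSpace β) (k : ℕ) :
    (ad ℂ R.KacMoodyAlgebra x ^ k) y ∈ R.rootSpace (β + k • α) := by
  induction k with
  | zero => simpa using hy
  | succ k ih =>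
    rw [pow_succ', Module.End.mul_apply, ad_apply, succ_nsmul, ← add_assoc]
    exact lie_mem_rootSpace hx ih

theorem map_mem_rootSpace {φ : R.KacMoodyAlgebra →ₗ⁅ℂ⁆ R.KacMoodyAlgebra} {w : 𝔥 ≃ₗ[ℂ] 𝔥}
    (hφ : ∀ h, φ (R.cartan h) = R.cartan (w h)) {α : Module.Dual ℂ 𝔥} {x : R.KacMoodyAlgebra}
    (hx : x ∈ R.rootSpace α) :
    φ x ∈ R.rootSpace (α ∘ₗ (w⁻¹ : 𝔥 ≃ₗ[ℂ] 𝔥).toLinearMap) := by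
  intro h
  have h1 : w ((w⁻¹ : 𝔥 ≃ₗ[ℂ] 𝔥) h) = h := w.apply_symm_apply h
  conv_lhs => rw [← h1]
  rw [← hφ, ← LieHom.map_lie, hx, map_smul]
  rfl

theorem exists_hom_weylGroup (hA : IsGCM A) {w : 𝔥 ≃ₗ[ℂ] 𝔥} (hw : w ∈ R.weylGroup) :
    ∃ φ : R.KacMoodyAlgebra →ₗ⁅ℂ⁆ R.KacMoodyAlgebra, Function.Injective φ ∧
      ∀ x, φ (R.cartan x) = R.cartan (w x) :=
  R.generators.exists_hom_weylGroup hA (R.engel_generators_E hA) (R.engel_generators_F hA) hw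

theorem Presents.comp {α : Module.Dual ℂ 𝔥} {p : (𝔥 ≃ₗ[ℂ] 𝔥) × I} (hp : R.Presents α p) :
    α ∘ₗ ((p.1⁻¹)⁻¹ : 𝔥 ≃ₗ[ℂ] 𝔥).toLinearMap = R.simpleRoot p.2 := by
  rw [hp.2, inv_inv]
  ext x
  exact congrArg (R.simpleRoot p.2) (p.1.symm_apply_apply x)

/-- Real root spaces have dimension at most one. -/
theorem Presents.exists_smul_eq (hA : IsGCM A) {α : Module.Dual ℂ 𝔥} {p : (𝔥 ≃ₗ[ℂ] 𝔥) × I}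
    (hp : R.Presents α p) {x y : R.KacMoodyAlgebra} (hx : x ∈ R.rootSpace α) (hx0 : x ≠ 0)
    (hy : y ∈ R.rootSpace α) : ∃ c : ℂ, y = c • x := by
  obtain ⟨φ, hφ, hφ'⟩ := exists_hom_weylGroup hA (inv_mem hp.1)
  -- The lift of `w⁻¹` embeds `𝔤_α` into the line `ℂeᵢ`.
  have key : ∀ z ∈ R.rootSpace α, ∃ c : ℂ, c • R.generators.E p.2 = φ z := fun z hz => by
    have h1 := map_mem_rootSpace hφ' hz
    rw [hp.comp] at h1
    exact Submodule.mem_span_singleton.1 (R.generators.mem_span_E p.2 h1)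
  obtain ⟨a, ha⟩ := key x hx
  obtain ⟨b, hb⟩ := key y hy
  have ha0 : a ≠ 0 := by
    rintro rfl
    exact hx0 (hφ (by rw [← ha, zero_smul, map_zero]))
  exact ⟨b / a, hφ (by rw [map_smul, ← ha, ← hb, smul_smul, div_mul_cancel₀ b ha0])⟩

/-- The `𝔰𝔩₂`-triple of a real root. -/
theorem Presents.exists_isSl2Relations (hA : IsGCM A) {α : Module.Dual ℂ 𝔥}
    {p : (𝔥 ≃ₗ[ℂ] 𝔥) × I} (hp : R.Presents α p) :
    ∃ e ∈ R.rootSpace α, ∃ f ∈ R.rootSpace (-α),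
      IsSl2Relations (R.cartan (p.1 (R.simpleCoroot p.2))) e f ∧
      LieSubalgebra.engel ℂ e = ⊤ ∧ LieSubalgebra.engel ℂ f = ⊤ := by
  obtain ⟨φ, hφ, hφ'⟩ := exists_hom_weylGroup hA hp.1
  obtain ⟨ψ, hψ, hψ'⟩ := exists_hom_weylGroup hA (inv_mem hp.1)
  have hE : R.generators.E p.2 ∈ R.rootSpace (R.simpleRoot p.2) := fun h =>
    R.generators.lie_H_E h p.2
  have hF : R.generators.F p.2 ∈ R.rootSpace (-R.simpleRoot p.2) := fun h =>
    (R.generators.lie_H_F h p.2).trans (by rw [LinearMap.neg_apply, neg_smul])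
  have he := map_mem_rootSpace hφ' hE
  have hf := map_mem_rootSpace hφ' hF
  rw [← hp.2] at he
  rw [LinearMap.neg_comp, ← hp.2] at hf
  have t := R.generators.isSl2Relations hA p.2
  refine ⟨_, he, _, hf, ⟨?_, ?_, ?_⟩, engel_eq_top_of_injective ψ hψ ?_,
    engel_eq_top_of_injective ψ hψ ?_⟩
  · rw [← LieHom.map_lie, t.lie_e_f, generators_H, hφ']
  · rw [← hφ', ← LieHom.map_lie, ← generators_H, t.lie_h_e, map_smul]
  · rw [← hφ', ← LieHom.map_lie, ← generators_H, t.lie_h_f, map_smul]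
  -- The lifts `φ` and `ψ` need not be inverse to each other, but weights force `ψ(φ(eᵢ))` to be a
  -- multiple of `eᵢ`; local nilpotency then pulls back along the injective `ψ`.
  · have h1 := map_mem_rootSpace hψ' he
    rw [hp.comp] at h1
    obtain ⟨c, hc⟩ := Submodule.mem_span_singleton.1 (R.generators.mem_span_E p.2 h1)
    rw [← hc]
    exact engel_smul_eq_top (R.engel_generators_E hA _) c
  · have h1 := map_mem_rootSpace hψ' hf
    rw [LinearMap.neg_comp, hp.comp] at h1
    have h2 : ∀ h, ⁅-R.cartan h, ψ (φ (R.generators.F p.2))⁆ =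
        R.simpleRoot p.2 h • ψ (φ (R.generators.F p.2)) := fun h => by
      rw [neg_lie, h1 h, LinearMap.neg_apply, neg_smul, neg_neg]
    obtain ⟨c, hc⟩ := Submodule.mem_span_singleton.1 (R.generators.opposite.mem_span_E p.2 h2)
    rw [← hc]
    exact engel_smul_eq_top (R.engel_generators_F hA _) c

theorem rootSpace_le_of_mem_rootsOf (hA : IsGCM A) {s : LieSubalgebra ℂ R.KacMoodyAlgebra}
    {α : Module.Dual ℂ 𝔥} {p : (𝔥 ≃ₗ[ℂ] 𝔥) × I} (hp : R.Presents α p) (hα : α ∈ R.rootsOf s) :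
    R.rootSpace α ≤ s.toSubmodule := by
  obtain ⟨x, ⟨hx, hxs⟩, hx0⟩ := Submodule.exists_mem_ne_zero_of_ne_bot hα.2
  intro y hy
  obtain ⟨c, rfl⟩ := hp.exists_smul_eq hA hx hx0 hy
  exact s.smul_mem c hxs

/-- Moving along a root string inside a subalgebra, in the direction of `α`. -/
theorem add_nsmul_mem_rootsOf (hA : IsGCM A) {s : LieSubalgebra ℂ R.KacMoodyAlgebra}
    {α β : Module.Dual ℂ 𝔥} {q : (𝔥 ≃ₗ[ℂ] 𝔥) × I} (hq : R.Presents β q) (hβ : β ∈ R.rootsOf s)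
    {e f : R.KacMoodyAlgebra} (he : e ∈ R.rootSpace α) (hes : e ∈ s) (hf : f ∈ R.rootSpace (-α))
    {u : 𝔥} (hu : α u = 2) (t : IsSl2Relations (R.cartan u) e f)
    (he' : LieSubalgebra.engel ℂ e = ⊤) (hf' : LieSubalgebra.engel ℂ f = ⊤) {m : ℤ} (hm : β u = m)
    {k : ℕ} (h0 : β + k • α ≠ 0) (hk : m + k ≤ 0 ∨ R.rootSpace (β + k • α) ≠ ⊥) :
    β + k • α ∈ R.rootsOf s := by
  obtain ⟨x, ⟨hx, hxs⟩, hx0⟩ := Submodule.exists_mem_ne_zero_of_ne_bot hβ.2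
  have h1 := ad_pow_mem_rootSpace he hx k
  have h2 : (ad ℂ R.KacMoodyAlgebra e ^ k) x ≠ 0 := by
    refine t.ad_e_pow_ne_zero he' hf' hx0 (m := m) (by rw [hx u, hm]) (hk.imp_right fun h => ?_)
    obtain ⟨y, hy, hy0⟩ := Submodule.exists_mem_ne_zero_of_ne_bot h
    refine ⟨y, hy0, ?_, hq.exists_smul_eq hA hx hx0 ?_⟩
    · rw [hy u, LinearMap.add_apply, LinearMap.smul_apply, hm, hu]
      push_cast
      rw [nsmul_eq_mul, mul_comm (2 : ℂ)]
    -- This is where `β` must be real: `f^k y` lies in `𝔤_β`, which is the line through `x`.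
    · have h3 := ad_pow_mem_rootSpace hf hy k
      rwa [show β + k • α + k • -α = β by rw [smul_neg, add_neg_cancel_right]] at h3
  have h3 : (ad ℂ R.KacMoodyAlgebra e ^ k) x ∈ s := by
    clear h1 h2 hk h0
    induction k with
    | zero => exact hxs
    | succ k ih =>
      rw [pow_succ', Module.End.mul_apply, ad_apply]
      exact s.lie_mem hes ih
  exact ⟨⟨h0, (Submodule.ne_bot_iff _).2 ⟨_, h1, h2⟩⟩, (Submodule.ne_bot_iff _).2 ⟨_, ⟨h1, h3⟩, h2⟩⟩

/-- In a symmetric subalgebra, the root string of real roots can be followed in both directions. -/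
theorem add_zsmul_mem_rootsOf (hA : IsGCM A) {s : LieSubalgebra ℂ R.KacMoodyAlgebra}
    (hsymm : R.IsSymmetric s) {α β : Module.Dual ℂ 𝔥} {p q : (𝔥 ≃ₗ[ℂ] 𝔥) × I}
    (hp : R.Presents α p) (hα : α ∈ R.rootsOf s) (hq : R.Presents β q) (hβ : β ∈ R.rootsOf s)
    {m : ℤ} (hm : β (p.1 (R.simpleCoroot p.2)) = m) {k : ℤ} (h0 : β + k • α ≠ 0)
    (hk : k = -m ∨ R.rootSpace (β + k • α) ≠ ⊥) : β + k • α ∈ R.rootsOf s := by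
  obtain ⟨e, he, f, hf, t, he', hf'⟩ := hp.exists_isSl2Relations hA
  obtain ⟨p', hp'⟩ := hp.neg hA
  have hα' : -α ∈ R.rootsOf s := by
    have : α ∈ {α | -α ∈ R.rootsOf s} := hsymm ▸ hα
    exact this
  have hes := rootSpace_le_of_mem_rootsOf hA hp hα he
  have hfs := rootSpace_le_of_mem_rootsOf hA hp' hα' hf
  have hu := hp.apply_self hA
  obtain ⟨n, rfl | rfl⟩ := k.eq_nat_or_neg
  -- The choice `k = -m` is the boundary case `m + k = 0` of the first alternative, so it needs no
  -- prior knowledge that `β + kα` is a root.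
  · rw [natCast_zsmul] at h0 hk ⊢
    exact add_nsmul_mem_rootsOf hA hq hβ he hes hf hu t he' hf' hm h0
      (hk.imp_left fun h => by omega)
  -- Downward steps use the triple `(-α^∨, f, e)` of `-α`, for which `m` becomes `-m`.
  · have h1 : β + (-(n : ℤ)) • α = β + n • -α := by rw [neg_smul, natCast_zsmul, smul_neg]
    rw [h1] at h0 hk ⊢
    refine add_nsmul_mem_rootsOf hA hq hβ hf hfs (by rwa [neg_neg])
      (u := -p.1 (R.simpleCoroot p.2)) (by rw [map_neg, LinearMap.neg_apply, hu, neg_neg])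
      (by rw [map_neg]; exact t.symm) hf' he' (m := -m) (by rw [map_neg, hm, Int.cast_neg]) h0
      (hk.imp_left fun h => by omega)

end Realization

theorem mainTheorem4 {I : Type*} [Fintype I] {𝔥 : Type*} [AddCommGroup 𝔥] [Module ℂ 𝔥]
    [FiniteDimensional ℂ 𝔥] (A : Matrix I I ℤ) (hA : IsGCM A) (hS : IsSymmetrizable A)
    (R : Realization A 𝔥) (s : LieSubalgebra ℂ R.KacMoodyAlgebra)
    (hreg : R.IsRegular s) (hsymm : R.IsSymmetric s) :
    (∀ α ∈ R.realRootsOf s, ∀ β ∈ R.realRootsOf s,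
      (α + β ∈ R.roots → α + β ∈ R.rootsOf s) ∧
      R.reflection α β ∈ R.rootsOf s ∧
      R.rootString α β ⊆ R.rootsOf s) ∧
    ((R.realRootsOf s).Nonempty →
      R.IsRealClosed (R.realRootsOf s) ∧ R.IsSubrootSystem (R.realRootsOf s)) := by
  have main : ∀ α ∈ R.realRootsOf s, ∀ β ∈ R.realRootsOf s,
      (α + β ∈ R.roots → α + β ∈ R.rootsOf s) ∧
      R.reflection α β ∈ R.rootsOf s ∧
      R.rootString α β ⊆ R.rootsOf s := by
    rintro α ⟨⟨-, p, hp⟩, hα⟩ β ⟨⟨-, q, hq⟩, hβ⟩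
    obtain ⟨m, hm⟩ := hp.exists_int hA hq
    have string : R.rootString α β ⊆ R.rootsOf s := by
      rintro _ ⟨hγ, k, rfl⟩
      exact Realization.add_zsmul_mem_rootsOf hA hsymm hp hα hq hβ hm hγ.1 (.inr hγ.2)
    refine ⟨fun h => string ⟨h, 1, by rw [one_smul, add_comm]⟩, ?_, string⟩
    have h1 : R.reflection α β = β + (-m) • α := by
      rw [Realization.reflection, R.coroot_eq hA hS hp, hm, Int.cast_smul_eq_zsmul, neg_smul,
        sub_eq_add_neg]
    rw [h1]
    refine Realization.add_zsmul_mem_rootsOf hA hsymm hp hα hq hβ hm (fun h => ?_) (.inl rfl)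
    -- If `β - mα = 0`, evaluation at `α^∨` gives `m - 2m = 0`, hence `m = 0` and `β = 0`, contrary
    -- to `β` being a root.
    have h2 := congrArg (fun γ => γ (p.1 (R.simpleCoroot p.2))) h
    simp only [LinearMap.add_apply, LinearMap.smul_apply, hm, hp.apply_self hA,
      LinearMap.zero_apply] at h2
    have h3 : m = 0 := by
      rw [zsmul_eq_mul] at h2
      push_cast at h2
      have h4 : (m : ℂ) = 0 := by linear_combination -h2
      exact_mod_cast h4
    rw [h3] at h
    exact hβ.1.1 (by simpa using h)
  refine ⟨main, fun hne => ⟨⟨hne, fun α hα => hα.1, fun α hα β hβ h => ?_⟩,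
    ⟨hne, fun α hα => hα.2.1, fun α hα β hβ => ?_⟩⟩⟩
  · exact ⟨h, (main α hα β hβ).1 h.1⟩
  · have h1 := (main α hα.1 β hβ).2.1
    obtain ⟨p, hp⟩ := hα.2.2
    obtain ⟨q, hq⟩ := hβ.1.2
    have h2 := hp.sub_smul hA hq
    rw [← R.coroot_eq hA hS hp] at h2
    exact ⟨⟨h1.1, _, h2⟩, h1⟩
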